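/- \textbf{Theorem (corrected trapezoidal rule for $-\log|x|$).} Let $K\ge 0$ be an integer. The linear system $$\sum_{j=0}^{K} w_j\, j^{2k} = -\zeta'(-2k),\qquad k=0,1,\dots,K \qquad (0^0:=1),$$ where $\zeta$ is the Riemann zeta function, has exactly one real solution $w_0,\dots,w_K$. Let $a>0$, let $p>2K+1$ be an integer, and let $\eta:\mathbb{R}\to\mathbb{R}$ be a $C^p$ function supported in $[-a,a]$ with $$\eta(0)=1,\qquad \eta^{(k)}(0)=0,\quad k=1,\dots,2K+1.$$ Let $\tau$ be a real- or complex-valued function that is $C^\infty$ on $[-a,a]$, and let $s(x)=-\log|x|$. For a function $g$ put $$I[g]=\int_{-a}^{a} g(x)\,dx,\qquad T_h^0[g]=\sum_{\substack{-M\le n\le M\\ n\neq 0}} g(nh)\,h,\qquad h=\frac{a}{M+\frac12},\quad M=1,2,\dots$$ Then $s\,\tau\,\eta$ is integrable on $[-a,a]$ and, as $M\to\infty$ (that is, as $h\to0^+$ along these grid spacings), $$I[s\,\tau\,\eta]=T_h^0[s\,\tau\,\eta]-\tau(0)\,h\log h+h\sum_{j=0}^{K}w_j\bigl(\tau(jh)+\tau(-jh)\bigr)+O\bigl(h^{2K+2}\bigr).$$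 -/

import Mathlib

open Set Filter MeasureTheory Asymptotics
open scoped ContDiff

namespace CorrectedTrapezoidal

/-- The integral `I[g]` of `g` over `[-a, a]`. -/
noncomputable def I {𝕜 : Type*} [RCLike 𝕜] (a : ℝ) (g : ℝ → 𝕜) : 𝕜 :=
  ∫ x in (-a)..a, g x

/-- The grid spacing `h = a / (M + 1/2)`. -/
noncomputable def spacing (a : ℝ) (M : ℕ) : ℝ := a / ((M : ℝ) + 1 / 2)

/-- The punctured trapezoidal rule: the sum of `g (n h) h` over `-M ≤ n ≤ M`, `n ≠ 0`, with
`h = a / (M + 1/2)`. -/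
noncomputable def puncturedTrapezoidal {𝕜 : Type*} [RCLike 𝕜] (a : ℝ) (M : ℕ) (g : ℝ → 𝕜) : 𝕜 :=
  ∑ n ∈ (Finset.Icc (-(M : ℤ)) (M : ℤ)).erase 0,
    g ((n : ℝ) * spacing a M) * ((spacing a M : ℝ) : 𝕜)

/-- The singular function `s(x) = -log |x|`. -/
noncomputable def negLogAbs (x : ℝ) : ℝ := -Real.log |x|

/-- The linear system `∑_{j=0}^K w_j j^{2k} = -ζ'(-2k)`, `k = 0, …, K` (with `0 ^ 0 = 1`). -/
def IsZetaPrimeWeights (K : ℕ) (w : Fin (K + 1) → ℝ) : Prop :=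
  ∀ k : ℕ, k ≤ K →
    ((∑ j : Fin (K + 1), w j * ((j : ℕ) : ℝ) ^ (2 * k) : ℝ) : ℂ) =
      -deriv riemannZeta (-(2 * (k : ℂ)))

/-- Cutoffs: `η ∈ C^p_c([-a, a])` with `η(0) = 1` and `η^{(k)}(0) = 0` for `1 ≤ k ≤ m`. -/
structure IsCutoff (a : ℝ) (p m : ℕ) (η : ℝ → ℝ) : Prop where
  contDiff : ContDiff ℝ p η
  tsupport_subset : tsupport η ⊆ Icc (-a) a
  map_zero : η 0 = 1
  iteratedDeriv_zero : ∀ k : ℕ, 1 ≤ k → k ≤ m → iteratedDeriv k η 0 = 0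

end CorrectedTrapezoidal

/-! Put `f x = η x τ x + η (-x) τ (-x)`. It is even, `C^(2K+2)`, and vanishes for `x ≥ a`; integral
and punctured sum become `-∫₀ᵃ log x • f x` and `-h ∑_{1≤n≤M} log (hn) • f (hn)`. With `X = M +
1/2`, so that `hX = a`, everything reduces to Euler-Maclaurin on `(0, X]` for `x ↦ log (hx) • f
(hx)`.

Near `0` the singularity is isolated by Taylor expansion. Only even powers occur, and `log (hx)
(hx)^(2k) = h^(2k) (x^(2k) log x + log h x^(2k))`. The Euler-Maclaurin formula for `x^u`, continued
analytically in `u`, has constant term `ζ(-u)` (`riemannZeta_neg_eq`). Its value and its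
`u`-derivative at `u = 2k` give the constants `ζ(-2k)` and `-ζ'(-2k)` for `x^(2k)` and `x^(2k) log
x`. Since `ζ(0) = -1/2` and `ζ(-2k) = 0` for `k ≥ 1`, the factor `log h` survives only at `k = 0`,
whence the term `τ(0) h log h`. The Taylor remainder vanishes to order `2K+2` at `0`, so its product
with `log` has an integrable derivative of that order and contributes no constant term
(`exists_norm_sum_logSMulDeriv_sub_le`).

The boundary terms at `X` of the separate pieces do not vanish, but their sum is the boundary term
of the whole function, which is zero because `f` vanishes beyond `a`
(`emBoundary_splitDeriv_eq_zero`). The remainders are `O(h^(2K+1))`, and the outer factor `h` gives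
`O(h^(2K+2))` (`exists_norm_sum_log_smul_sub_le`).

Finally the moment equations turn `∑ h^(2k) (-ζ'(-2k)) f^(2k)(0)/(2k)!` into `∑ w_j P(jh)`, with `P`
the Taylor polynomial of `f`. Replacing `P` by `f`, then `f(jh)` by `τ(jh) + τ(-jh)` thanks to the
flatness of `η` at `0`, costs `O(h^(2K+2))` each time. The weights exist and are unique by a
Vandermonde determinant in the nodes `j^2`. -/

namespace CorrectedTrapezoidal

/-! ### Periodic Bernoulli functions -/

/-- The one-periodic extension of the Bernoulli polynomial `B_k`, divided by `k!`. -/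
noncomputable def perBernoulli (k : ℕ) (x : ℝ) : ℝ :=
  bernoulliFun k (Int.fract x) / (k.factorial : ℝ)

theorem perBernoulli_one (x : ℝ) : perBernoulli 1 x = Int.fract x - 1 / 2 := by
  simp [perBernoulli]

theorem measurable_perBernoulli (k : ℕ) : Measurable (perBernoulli k) :=
  ((continuous_bernoulliFun k).measurable.comp measurable_fract).div_const _

theorem continuous_perBernoulli {k : ℕ} (hk : k ≠ 1) : Continuous (perBernoulli k) := by
  refine Continuous.div_const ?_ _
  exact ContinuousOn.comp_fract'' (continuous_bernoulliFun k).continuousOn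
    (bernoulliFun_endpoints_eq_of_ne_one hk).symm

theorem exists_abs_perBernoulli_le (k : ℕ) : ∃ C : ℝ, 0 < C ∧ ∀ x, |perBernoulli k x| ≤ C := by
  obtain ⟨C, hC⟩ := (isCompact_Icc (a := (0 : ℝ)) (b := 1)).exists_bound_of_continuousOn
    (f := fun x => bernoulliFun k x / (k.factorial : ℝ))
    ((continuous_bernoulliFun k).div_const _).continuousOn
  refine ⟨max C 1, by positivity, fun x => le_max_of_le_left ?_⟩
  exact hC _ ⟨Int.fract_nonneg x, (Int.fract_lt_one x).le⟩

/-- The floor is constant immediately to the right of any point, so `B_{k+1}' = (k+1) B_k` survives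
periodization as a right derivative, integers included. This one-sided form suffices for integration
by parts. -/
theorem hasDerivWithinAt_perBernoulli (k : ℕ) (x : ℝ) :
    HasDerivWithinAt (perBernoulli (k + 1)) (perBernoulli k x) (Ioi x) x := by
  have h1 : HasDerivAt (fun y : ℝ => bernoulliFun (k + 1) (y - ⌊x⌋) / ((k + 1).factorial : ℝ))
      (perBernoulli k x) x := by
    have h := ((hasDerivAt_bernoulliFun (k + 1) (x - ⌊x⌋)).comp x
      ((hasDerivAt_id x).sub_const (⌊x⌋ : ℝ))).div_const ((k + 1).factorial : ℝ)
    refine h.congr_deriv ?_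
    rw [perBernoulli, Int.fract, Nat.factorial_succ]
    push_cast
    have : (k.factorial : ℝ) ≠ 0 := by positivity
    simp
    field_simp
  refine h1.hasDerivWithinAt.congr_of_eventuallyEq ?_ rfl
  have : Ioo x (⌊x⌋ + 1) ∈ nhdsWithin x (Ioi x) := Ioo_mem_nhdsGT (Int.lt_floor_add_one x)
  filter_upwards [this] with y hy
  have hfl : ⌊y⌋ = ⌊x⌋ := Int.floor_eq_iff.2 ⟨(Int.floor_le x).trans hy.1.le, hy.2⟩
  rw [perBernoulli, Int.fract, hfl]

/-! ### Euler-Maclaurin formula with real endpoints -/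

section EulerMaclaurin

variable {E : Type*} [NormedAddCommGroup E] [NormedSpace ℝ E]

theorem intervalIntegrable_perBernoulli_smul (k : ℕ) {g : ℝ → E} {A B : ℝ}
    (hg : IntervalIntegrable g volume A B) :
    IntervalIntegrable (fun x => perBernoulli k x • g x) volume A B := by
  obtain ⟨C, -, hC⟩ := exists_abs_perBernoulli_le k
  rw [intervalIntegrable_iff] at hg ⊢
  exact hg.bdd_smul C (measurable_perBernoulli k).aestronglyMeasurable (ae_of_all _ hC)

/-- The boundary terms at `x` of the Euler-Maclaurin formula of order `m`. -/
noncomputable def emBoundary (m : ℕ) (g : ℕ → ℝ → E) (x : ℝ) : E :=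
  ∑ j ∈ Finset.range m, (-1 : ℝ) ^ (j + 1) • perBernoulli (j + 1) x • g j x

variable [CompleteSpace E]

theorem integral_perBernoulli_one_smul_deriv_of_cell {g g' : ℝ → E} {A B : ℝ} (n : ℕ)
    (hA : (n : ℝ) ≤ A) (hAB : A ≤ B) (hB : B ≤ n + 1)
    (hcont : ContinuousOn g (Icc A B)) (hder : ∀ x ∈ Ioo A B, HasDerivAt g (g' x) x)
    (hint : IntervalIntegrable g' volume A B) :
    ∫ x in A..B, perBernoulli 1 x • g' x =
      (B - n - 1 / 2) • g B - (A - n - 1 / 2) • g A - ∫ x in A..B, g x := by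
  have h1 : ∫ x in A..B, perBernoulli 1 x • g' x = ∫ x in A..B, (x - n - 1 / 2) • g' x := by
    refine intervalIntegral.integral_congr_ae ?_
    -- `B` may be the integer `n + 1`, where the periodic function has already jumped; this point is
    -- null.
    have : ∀ᵐ x : ℝ, x ≠ B := by simp [ae_iff]
    filter_upwards [this] with x hx hx'
    rw [uIoc_of_le hAB] at hx'
    have : x < n + 1 := (lt_of_le_of_ne hx'.2 hx).trans_le hB
    have hfl : ⌊x⌋ = (n : ℤ) := Int.floor_eq_iff.2
      ⟨by exact_mod_cast hA.trans hx'.1.le, by exact_mod_cast this⟩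
    rw [perBernoulli_one, Int.fract, hfl]
    simp
  have h2 := intervalIntegral.integral_smul_deriv_eq_deriv_smul_of_hasDerivAt
    (u := fun x : ℝ => x - n - 1 / 2) (u' := fun _ => 1) (v := g) (v' := g') (a := A) (b := B)
    (by fun_prop) (by rwa [uIcc_of_le hAB])
    (fun x _ => by simpa using ((hasDerivAt_id x).sub_const (n : ℝ)).sub_const (1 / 2 : ℝ))
    (by simpa [hAB] using hder) (by simp) hint
  rw [h1, h2]
  simp

theorem sum_Ioc_eq_integral_of_cell {g g' : ℝ → E} {A B : ℝ} (hA0 : 0 ≤ A) (hAB : A ≤ B)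
    (hB : B ≤ ⌊A⌋₊ + 1)
    (hcont : ContinuousOn g (Icc A B)) (hder : ∀ x ∈ Ioo A B, HasDerivAt g (g' x) x)
    (hint : IntervalIntegrable g' volume A B) :
    ∑ n ∈ Finset.Ioc ⌊A⌋₊ ⌊B⌋₊, g n = (∫ x in A..B, g x) -
      (perBernoulli 1 B • g B - perBernoulli 1 A • g A) +
      ∫ x in A..B, perBernoulli 1 x • g' x := by
  rw [integral_perBernoulli_one_smul_deriv_of_cell ⌊A⌋₊ (Nat.floor_le hA0) hAB hB hcont hder hint]
  have hfA : Int.fract A = A - ⌊A⌋₊ := by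
    rw [Int.fract, ← natCast_floor_eq_intCast_floor hA0]
  rcases hB.lt_or_eq with h | h
  -- No integer lies in `(A, B]`, so the sum is empty. In the other case `B` is an integer, and the
  -- jump of `perBernoulli 1` from `1/2` to `-1/2` supplies the single summand `g B`.
  · have hfl : ⌊B⌋₊ = ⌊A⌋₊ :=
      (Nat.floor_eq_iff (hA0.trans hAB)).2 ⟨(Nat.floor_le hA0).trans hAB, h⟩
    have hfB : Int.fract B = B - ⌊A⌋₊ := by
      rw [Int.fract, ← natCast_floor_eq_intCast_floor (hA0.trans hAB), hfl]
    rw [hfl, perBernoulli_one, perBernoulli_one, hfA, hfB]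
    simp
  · have hB' : B = ((⌊A⌋₊ + 1 : ℕ) : ℝ) := by push_cast; exact h
    have hfl : ⌊B⌋₊ = ⌊A⌋₊ + 1 := by rw [hB', Nat.floor_natCast]
    have hfB : Int.fract B = 0 := by rw [hB']; exact Int.fract_natCast _
    rw [hfl, perBernoulli_one, perBernoulli_one, hfA, hfB]
    have : (B - ⌊A⌋₊ - 1 / 2 : ℝ) = 1 / 2 := by rw [h]; ring
    rw [this]
    simp only [Nat.Ioc_succ_singleton, Finset.sum_singleton]
    rw [← hB']
    module

theorem sum_Ioc_eq_integral_add_integral_perBernoulli_one {g g' : ℝ → E} {A B : ℝ}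
    (hA0 : 0 ≤ A) (hAB : A ≤ B)
    (hcont : ContinuousOn g (Icc A B)) (hder : ∀ x ∈ Ioo A B, HasDerivAt g (g' x) x)
    (hint : IntervalIntegrable g' volume A B) :
    ∑ n ∈ Finset.Ioc ⌊A⌋₊ ⌊B⌋₊, g n = (∫ x in A..B, g x) -
      (perBernoulli 1 B • g B - perBernoulli 1 A • g A) +
      ∫ x in A..B, perBernoulli 1 x • g' x := by
  -- `N` bounds the number of integer points at which `[A, B]` is cut into cells; the induction
  -- removes the last cell.
  obtain ⟨N, hN⟩ : ∃ N : ℕ, B ≤ ⌊A⌋₊ + 1 + N := by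
    obtain ⟨N, hN⟩ := exists_nat_ge (B - (⌊A⌋₊ + 1))
    exact ⟨N, by linarith⟩
  induction N generalizing B with
  | zero => exact sum_Ioc_eq_integral_of_cell hA0 hAB (by simpa using hN) hcont hder hint
  | succ N ih =>
    rcases le_total B (⌊A⌋₊ + 1 + N) with h | h
    · exact ih hAB hcont hder hint h
    · set D : ℝ := ⌊A⌋₊ + 1 + N with hD
      have hAD : A ≤ D := by
        have := Nat.lt_floor_add_one A
        have : (0 : ℝ) ≤ N := N.cast_nonneg
        linarith
      have hD0 : 0 ≤ D := hA0.trans hAD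
      have hDn : D = ((⌊A⌋₊ + 1 + N : ℕ) : ℝ) := by push_cast; rfl
      have hDf : ⌊D⌋₊ = ⌊A⌋₊ + 1 + N := by rw [hDn, Nat.floor_natCast]
      have hi1 : IntervalIntegrable g' volume A D :=
        hint.mono_set (by rw [uIcc_of_le hAD, uIcc_of_le hAB]; exact Icc_subset_Icc_right h)
      have hi2 : IntervalIntegrable g' volume D B :=
        hint.mono_set (by rw [uIcc_of_le h, uIcc_of_le hAB]; exact Icc_subset_Icc_left hAD)
      have hc1 := hcont.mono (Icc_subset_Icc_right h : Icc A D ⊆ Icc A B)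
      have hc2 := hcont.mono (Icc_subset_Icc_left hAD : Icc D B ⊆ Icc A B)
      have e1 := ih hAD hc1 (fun x hx => hder x ⟨hx.1, hx.2.trans_le h⟩) hi1 le_rfl
      have e2 := sum_Ioc_eq_integral_of_cell hD0 h
        (by rw [hDf]; push_cast at hN ⊢; linarith) hc2
        (fun x hx => hder x ⟨hAD.trans_lt hx.1, hx.2⟩) hi2
      rw [← Finset.sum_Ioc_consecutive _ (Nat.floor_le_floor hAD) (Nat.floor_le_floor h), e1, e2,
        ← intervalIntegral.integral_add_adjacent_intervals
          (hc1.intervalIntegrable_of_Icc hAD) (hc2.intervalIntegrable_of_Icc h),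
        ← intervalIntegral.integral_add_adjacent_intervals
          (intervalIntegrable_perBernoulli_smul 1 hi1) (intervalIntegrable_perBernoulli_smul 1 hi2)]
      module

/-- The **Euler-Maclaurin formula**, for a sequence of successive derivatives. -/
theorem sum_Ioc_eq_integral_add_emBoundary (m : ℕ) {g : ℕ → ℝ → E} {A B : ℝ}
    (hA0 : 0 ≤ A) (hAB : A ≤ B)
    (hcont : ∀ j ≤ m, ContinuousOn (g j) (Icc A B))
    (hder : ∀ j ≤ m, ∀ x ∈ Ioo A B, HasDerivAt (g j) (g (j + 1) x) x)
    (hint : IntervalIntegrable (g (m + 1)) volume A B) :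
    ∑ n ∈ Finset.Ioc ⌊A⌋₊ ⌊B⌋₊, g 0 n = (∫ x in A..B, g 0 x) +
      (emBoundary (m + 1) g B - emBoundary (m + 1) g A) +
      (-1 : ℝ) ^ m • ∫ x in A..B, perBernoulli (m + 1) x • g (m + 1) x := by
  induction m with
  | zero =>
    rw [sum_Ioc_eq_integral_add_integral_perBernoulli_one hA0 hAB (hcont 0 le_rfl)
      (hder 0 le_rfl) hint]
    simp [emBoundary]
    module
  | succ m ih =>
    have hi : IntervalIntegrable (g (m + 1)) volume A B :=
      (hcont (m + 1) le_rfl).intervalIntegrable_of_Icc hAB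
    rw [ih (fun j hj => hcont j (by lia)) (fun j hj => hder j (by lia)) hi]
    -- From index `2` on the periodic Bernoulli functions are continuous, so integration by parts
    -- runs across the integers without jump terms.
    have key := intervalIntegral.integral_smul_deriv_eq_deriv_smul_of_hasDeriv_right
      (u := perBernoulli (m + 2)) (u' := perBernoulli (m + 1)) (v := g (m + 1))
      (v' := g (m + 2)) (a := A) (b := B)
      (continuous_perBernoulli (by lia)).continuousOn
      (by rw [uIcc_of_le hAB]; exact hcont (m + 1) le_rfl)
      (fun x _ => hasDerivWithinAt_perBernoulli (m + 1) x)
      (fun x hx => (hder (m + 1) le_rfl x (by simpa [hAB] using hx)).hasDerivWithinAt)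
      (by
        have := intervalIntegrable_perBernoulli_smul (m + 1) (g := fun _ => (1 : ℝ)) (A := A) (B := B)
          (by simp)
        simpa using this) hint
    rw [show m + 1 + 1 = m + 2 from rfl, key]
    simp only [emBoundary]
    rw [Finset.sum_range_succ _ (m + 1), Finset.sum_range_succ _ (m + 1)]
    simp only [pow_succ]
    module

end EulerMaclaurin

/-! ### Euler-Maclaurin for complex powers and the zeta function -/

/-- The successive derivatives of `x ↦ x ^ u`. -/
noncomputable def cpowDeriv (u : ℂ) (j : ℕ) (x : ℝ) : ℂ :=
  (descPochhammer ℂ j).eval u * (x : ℂ) ^ (u - j)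

theorem hasDerivAt_cpowDeriv (u : ℂ) (j : ℕ) {x : ℝ} (hx : 0 < x) :
    HasDerivAt (cpowDeriv u j) (cpowDeriv u (j + 1) x) x := by
  have h : HasDerivAt (fun z : ℂ => z ^ (u - j)) ((u - j) * (x : ℂ) ^ (u - j - 1) * 1) (x : ℂ) :=
    (hasDerivAt_id (x : ℂ)).cpow_const (Complex.ofReal_mem_slitPlane.2 hx)
  refine (h.comp_ofReal.const_mul ((descPochhammer ℂ j).eval u)).congr_deriv ?_
  rw [cpowDeriv, descPochhammer_succ_eval]
  push_cast
  rw [sub_sub]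
  ring

theorem continuousOn_cpowDeriv (u : ℂ) (j : ℕ) : ContinuousOn (cpowDeriv u j) (Ioi 0) :=
  fun _ hx => (hasDerivAt_cpowDeriv u j hx).continuousAt.continuousWithinAt

theorem integrableOn_perBernoulli_mul_cpow (n : ℕ) {u : ℂ} (hu : u.re < -1) {X : ℝ} (hX : 0 < X) :
    IntegrableOn (fun x : ℝ => (perBernoulli n x : ℂ) * (x : ℂ) ^ u) (Ioi X) := by
  obtain ⟨C, -, hC⟩ := exists_abs_perBernoulli_le n
  refine (integrableOn_Ioi_cpow_of_lt hu hX).bdd_mul (c := C)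
    (Complex.measurable_ofReal.comp (measurable_perBernoulli n)).aestronglyMeasurable
    (ae_of_all _ fun x => ?_)
  simpa using hC x

/-- The remainder integral of the Euler-Maclaurin formula for `x ↦ x ^ u` on `(X, ∞)`. -/
noncomputable def cpowRemainder (n : ℕ) (X : ℝ) (u : ℂ) : ℂ :=
  ∫ x in Ioi X, (perBernoulli n x : ℂ) * (x : ℂ) ^ (u - n)

theorem tendsto_emBoundary_cpowDeriv (n : ℕ) {u : ℂ} (hu : u.re < -1) {X : ℝ} (hX : 0 < X) :
    Tendsto (fun N : ℕ => emBoundary n (cpowDeriv u) (X + N)) atTop (nhds 0) := by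
  rw [show (0 : ℂ) = ∑ j ∈ Finset.range n, 0 by simp]
  refine tendsto_finsetSum _ fun j _ => ?_
  obtain ⟨C, -, hC⟩ := exists_abs_perBernoulli_le (j + 1)
  have hlim : Tendsto (fun N : ℕ => C * (‖(descPochhammer ℂ j).eval u‖ *
      (X + N) ^ (-(j - u.re : ℝ)))) atTop (nhds (C * (‖(descPochhammer ℂ j).eval u‖ * 0))) := by
    refine Tendsto.const_mul _ (Tendsto.const_mul _ ?_)
    refine (tendsto_rpow_neg_atTop (by have : (0 : ℝ) ≤ j := j.cast_nonneg; linarith)).comp ?_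
    exact tendsto_atTop_add_const_left _ _ tendsto_natCast_atTop_atTop
  rw [mul_zero, mul_zero] at hlim
  refine squeeze_zero_norm (fun N => ?_) hlim
  have hpos : 0 < X + (N : ℝ) := by positivity
  rw [norm_smul, norm_smul, cpowDeriv, norm_mul, Complex.norm_cpow_eq_rpow_re_of_pos hpos]
  simp only [norm_pow, norm_neg, norm_one, one_pow, one_mul, Complex.sub_re, Complex.natCast_re,
    Real.norm_eq_abs, neg_sub]
  gcongr
  exact hC _

/-- In the region of convergence, Euler-Maclaurin on `(X, X + N]` has a limit as `N → ∞`: the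
boundary term at the far end decays and both integrals converge. -/
theorem riemannZeta_neg_eq_of_re_lt (m : ℕ) {u : ℂ} (hu : u.re < -1) {X : ℝ} (hX : 0 < X) :
    riemannZeta (-u) = (∑ n ∈ Finset.Ioc 0 ⌊X⌋₊, (n : ℂ) ^ u) - (X : ℂ) ^ (u + 1) / (u + 1) -
      emBoundary (m + 1) (cpowDeriv u) X +
      (-1) ^ m * ((descPochhammer ℂ (m + 1)).eval u * cpowRemainder (m + 1) X u) := by
  have hu' : 1 < (-u).re := by simpa using by linarith
  have hu0 : u ≠ 0 := by rintro rfl; simp at hu; linarith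
  have hfl : ∀ N : ℕ, ⌊X + N⌋₊ = ⌊X⌋₊ + N := fun N => Nat.floor_add_natCast hX.le N
  have hEM : ∀ N : ℕ, ∑ n ∈ Finset.range (⌊X⌋₊ + N + 1), 1 / (n : ℂ) ^ (-u) =
      (∑ n ∈ Finset.Ioc 0 ⌊X⌋₊, (n : ℂ) ^ u) + ((∫ x in X..(X + N), (x : ℂ) ^ u) +
      (emBoundary (m + 1) (cpowDeriv u) (X + N) - emBoundary (m + 1) (cpowDeriv u) X) +
      (-1) ^ m * ((descPochhammer ℂ (m + 1)).eval u *
        ∫ x in X..(X + N), (perBernoulli (m + 1) x : ℂ) * (x : ℂ) ^ (u - (m + 1 : ℕ)))) := by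
    intro N
    have hXN : X ≤ X + N := by simp
    have hsub : Icc X (X + N) ⊆ Ioi 0 := fun x hx => hX.trans_le hx.1
    have h := sum_Ioc_eq_integral_add_emBoundary m (g := cpowDeriv u) hX.le hXN
      (fun j _ => (continuousOn_cpowDeriv u j).mono hsub)
      (fun j _ x hx => hasDerivAt_cpowDeriv u j (hX.trans hx.1))
      (((continuousOn_cpowDeriv u (m + 1)).mono hsub).intervalIntegrable_of_Icc hXN)
    have h0 : cpowDeriv u 0 = fun x : ℝ => (x : ℂ) ^ u := by ext x; simp [cpowDeriv]
    rw [h0, hfl] at h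
    have hS : ∑ n ∈ Finset.range (⌊X⌋₊ + N + 1), 1 / (n : ℂ) ^ (-u) =
        ∑ n ∈ Finset.Ioc 0 (⌊X⌋₊ + N), (n : ℂ) ^ u := by
      rw [Finset.range_eq_Ico, Finset.sum_eq_sum_Ico_succ_bot (by lia)]
      have : Finset.Ico (0 + 1) (⌊X⌋₊ + N + 1) = Finset.Ioc 0 (⌊X⌋₊ + N) := by
        ext; simp; lia
      rw [this]
      simp [Complex.cpow_neg, hu0]
    rw [hS, ← Finset.sum_Ioc_consecutive _ (Nat.zero_le ⌊X⌋₊) (Nat.le_add_right _ N)]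
    congr 1
    push_cast at h
    rw [h]
    congr 1
    simp only [cpowDeriv, Complex.real_smul]
    push_cast
    congr 1
    rw [← intervalIntegral.integral_const_mul]
    congr 1
    ext x
    ring
  have hL : Tendsto (fun N : ℕ => ∑ n ∈ Finset.range (⌊X⌋₊ + N + 1), 1 / (n : ℂ) ^ (-u)) atTop
      (nhds (riemannZeta (-u))) := by
    rw [zeta_eq_tsum_one_div_nat_cpow hu']
    refine ((Complex.summable_one_div_nat_cpow.2 hu').hasSum.tendsto_sum_nat).comp ?_
    refine tendsto_atTop_mono (fun N => ?_) tendsto_id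
    simp only [id]; lia
  have hXt : Tendsto (fun N : ℕ => X + (N : ℝ)) atTop atTop :=
    tendsto_atTop_add_const_left _ _ tendsto_natCast_atTop_atTop
  have hR := ((((intervalIntegral_tendsto_integral_Ioi X (integrableOn_Ioi_cpow_of_lt hu hX)
    hXt).add ((tendsto_emBoundary_cpowDeriv (m + 1) hu hX).sub_const
      (emBoundary (m + 1) (cpowDeriv u) X))).add
    ((((intervalIntegral_tendsto_integral_Ioi X (integrableOn_perBernoulli_mul_cpow (m + 1)
      (u := u - (m + 1 : ℕ)) (by simp; linarith) hX) hXt).const_mul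
      ((descPochhammer ℂ (m + 1)).eval u)).const_mul ((-1 : ℂ) ^ m)))).const_add
    (∑ n ∈ Finset.Ioc 0 ⌊X⌋₊, (n : ℂ) ^ u))
  have := tendsto_nhds_unique hL (hR.congr fun N => (hEM N).symm)
  rw [this, integral_Ioi_cpow_of_lt hu hX, cpowRemainder]
  ring

/-- The remainder is a shifted Mellin transform of a bounded function that vanishes near `0`, hence
holomorphic in a half-plane. -/
theorem differentiableAt_cpowRemainder (n : ℕ) {X : ℝ} (hX : 0 < X) {u : ℂ} (hu : u.re < n - 1) :
    DifferentiableAt ℂ (cpowRemainder n X) u := by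
  have h1 : cpowRemainder n X =
      fun u => mellin ((Ioi X).indicator fun x => (perBernoulli n x : ℂ)) (u - n + 1) := by
    ext u
    rw [cpowRemainder, mellin]
    have : ∀ t : ℝ, (t : ℂ) ^ (u - n + 1 - 1) •
        (Ioi X).indicator (fun x => (perBernoulli n x : ℂ)) t =
        (Ioi X).indicator (fun x : ℝ => (perBernoulli n x : ℂ) * (x : ℂ) ^ (u - n)) t := by
      intro t
      by_cases ht : t ∈ Ioi X <;> simp [ht, mul_comm]
    simp_rw [this]
    rw [setIntegral_indicator measurableSet_Ioi, Ioi_inter_Ioi, max_eq_right hX.le]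
  obtain ⟨C, hC0, hC⟩ := exists_abs_perBernoulli_le n
  have hb : ∀ x, ‖(Ioi X).indicator (fun x => (perBernoulli n x : ℂ)) x‖ ≤ C := by
    intro x
    by_cases hx : x ∈ Ioi X
    · simpa [hx] using hC x
    · simpa [hx] using hC0.le
  have hmeas : Measurable ((Ioi X).indicator fun x => (perBernoulli n x : ℂ)) :=
    (Complex.measurable_ofReal.comp (measurable_perBernoulli n)).indicator measurableSet_Ioi
  rw [h1]
  have h2 : DifferentiableAt ℂ (mellin ((Ioi X).indicator fun x => (perBernoulli n x : ℂ)))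
      (u - n + 1) := by
    refine mellin_differentiableAt_of_isBigO_rpow (a := 0) (b := (u - n + 1).re - 1) ?_ ?_ ?_ ?_ ?_
    · refine LocallyIntegrable.locallyIntegrableOn ?_ _
      refine (locallyIntegrable_const C).mono hmeas.aestronglyMeasurable (ae_of_all _ fun x => ?_)
      exact (hb x).trans (le_abs_self C)
    · refine IsBigO.of_bound C (Eventually.of_forall fun x => ?_)
      simpa using hb x
    · simp; linarith
    · refine IsBigO.of_bound 0 ?_
      filter_upwards [Ioo_mem_nhdsGT hX] with x hx
      have : x ∉ Ioi X := notMem_Ioi.2 hx.2.le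
      simp [this]
    · linarith
  exact DifferentiableAt.comp (f := fun u : ℂ => u - n + 1) u h2 (by fun_prop)

/-- The successive derivatives of `x ↦ x ^ u * log x`. -/
noncomputable def cpowLogDeriv (u : ℂ) (j : ℕ) (x : ℝ) : ℂ :=
  (descPochhammer ℂ j).derivative.eval u * (x : ℂ) ^ (u - j) +
    (descPochhammer ℂ j).eval u * ((x : ℂ) ^ (u - j) * Complex.log x)

theorem hasDerivAt_cpowDeriv_exponent (u : ℂ) (j : ℕ) {x : ℝ} (hx : 0 < x) :
    HasDerivAt (fun u => cpowDeriv u j x) (cpowLogDeriv u j x) u := by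
  have h1 : HasDerivAt (fun u : ℂ => (x : ℂ) ^ (u - j)) ((x : ℂ) ^ (u - j) * Complex.log x * 1) u :=
    ((hasDerivAt_id u).sub_const (j : ℂ)).const_cpow (Or.inl (by exact_mod_cast hx.ne'))
  refine (((descPochhammer ℂ j).hasDerivAt u).mul h1).congr_deriv ?_
  rw [cpowLogDeriv, mul_one]

theorem hasDerivAt_emBoundary_exponent (n : ℕ) (u : ℂ) {X : ℝ} (hX : 0 < X) :
    HasDerivAt (fun u => emBoundary n (cpowDeriv u) X) (emBoundary n (cpowLogDeriv u) X) u := by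
  simp only [emBoundary]
  refine HasDerivAt.fun_sum fun j _ => ?_
  exact ((hasDerivAt_cpowDeriv_exponent u j hX).const_smul _).const_smul _

theorem hasDerivAt_sum_natCast_cpow (N : ℕ) (u : ℂ) :
    HasDerivAt (fun u : ℂ => ∑ n ∈ Finset.Ioc 0 N, (n : ℂ) ^ u)
      (∑ n ∈ Finset.Ioc 0 N, (n : ℂ) ^ u * Complex.log n) u := by
  refine HasDerivAt.fun_sum fun n hn => ?_
  have hn0 : (n : ℂ) ≠ 0 := by
    have := (Finset.mem_Ioc.1 hn).1
    exact_mod_cast this.ne'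
  simpa using (hasDerivAt_id u).const_cpow (c := (n : ℂ)) (Or.inl hn0)

/-- The Euler-Maclaurin formula for the Riemann zeta function. -/
theorem riemannZeta_neg_eq (m : ℕ) {u : ℂ} (hu : u.re < m) (hu1 : u ≠ -1) {X : ℝ} (hX : 0 < X) :
    riemannZeta (-u) = (∑ n ∈ Finset.Ioc 0 ⌊X⌋₊, (n : ℂ) ^ u) - (X : ℂ) ^ (u + 1) / (u + 1) -
      emBoundary (m + 1) (cpowDeriv u) X +
      (-1) ^ m * ((descPochhammer ℂ (m + 1)).eval u * cpowRemainder (m + 1) X u) := by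
  set U : Set ℂ := {u | u.re < m} with hU
  have hUo : IsOpen U := isOpen_lt Complex.continuous_re continuous_const
  have hUc : IsPreconnected U := (convex_halfSpace_re_lt (m : ℝ)).isPreconnected
  -- Multiplication by `-(u + 1)` cancels the pole at `u = -1`, so both sides are holomorphic on the
  -- whole half-plane and the identity theorem applies there.
  set G : ℂ → ℂ := fun u => (X : ℂ) ^ (u + 1) - (u + 1) * ((∑ n ∈ Finset.Ioc 0 ⌊X⌋₊, (n : ℂ) ^ u) -
      emBoundary (m + 1) (cpowDeriv u) X +
      (-1) ^ m * ((descPochhammer ℂ (m + 1)).eval u * cpowRemainder (m + 1) X u)) with hG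
  have hX0 : (X : ℂ) ≠ 0 := by exact_mod_cast hX.ne'
  have hmul : ∀ v : ℂ, v ≠ -1 → riemannZeta₁ (-v) = -(v + 1) * riemannZeta (-v) := by
    intro v hv
    have h1 : -v ≠ 1 := fun h => hv (by rw [← h, neg_neg])
    have h2 : -v - 1 ≠ 0 := sub_ne_zero.2 h1
    rw [riemannZeta_eq_inv_sub_mul h1, show -(v + 1) = -v - 1 by ring, mul_inv_cancel_left₀ h2]
  have hF : AnalyticOnNhd ℂ (fun u => riemannZeta₁ (-u)) U :=
    (differentiable_riemannZeta₁.comp differentiable_neg).differentiableOn.analyticOnNhd hUo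
  have hGa : AnalyticOnNhd ℂ G U := by
    refine DifferentiableOn.analyticOnNhd (fun v hv => ?_) hUo
    refine DifferentiableAt.differentiableWithinAt ?_
    have hS := (hasDerivAt_sum_natCast_cpow ⌊X⌋₊ v).differentiableAt
    have hB := (hasDerivAt_emBoundary_exponent (m + 1) v hX).differentiableAt
    have hJ := differentiableAt_cpowRemainder (m + 1) hX (u := v) (by
      have : v.re < m := hv
      push_cast; linarith)
    have hP : DifferentiableAt ℂ (fun u => (descPochhammer ℂ (m + 1)).eval u) v :=
      (descPochhammer ℂ (m + 1)).differentiableAt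
    have hXp : DifferentiableAt ℂ (fun u : ℂ => (X : ℂ) ^ (u + 1)) v :=
      DifferentiableAt.const_cpow (by fun_prop) (Or.inl hX0)
    exact hXp.sub ((by fun_prop : DifferentiableAt ℂ (fun u : ℂ => u + 1) v).mul
      ((hS.sub hB).add ((hP.mul hJ).const_mul _)))
  -- The point `-2` lies inside the region of convergence `re u < -1`.
  have hev : (fun u => riemannZeta₁ (-u)) =ᶠ[nhds (-2)] G := by
    have : {v : ℂ | v.re < -1} ∈ nhds (-2 : ℂ) :=
      (isOpen_lt Complex.continuous_re continuous_const).mem_nhds (by simp)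
    filter_upwards [this] with v hv
    have hv1 : v ≠ -1 := by rintro rfl; simp at hv
    have hv1' : v + 1 ≠ 0 := fun h => hv1 (eq_neg_of_add_eq_zero_left h)
    rw [hmul v hv1, riemannZeta_neg_eq_of_re_lt m hv hX, hG]
    field_simp
    ring
  have hEq := hF.eqOn_of_preconnected_of_eventuallyEq hGa hUc (z₀ := -2)
    (by simp only [hU, mem_ofPred_eq, Complex.neg_re, Complex.re_ofNat]
        have : (0 : ℝ) ≤ m := m.cast_nonneg
        linarith) hev hu
  have hu1' : u + 1 ≠ 0 := fun h => hu1 (eq_neg_of_add_eq_zero_left h)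
  have h3 : -(u + 1) * riemannZeta (-u) = G u := by rw [← hmul u hu1]; exact hEq
  have h4 : riemannZeta (-u) = -(G u) / (u + 1) := by rw [← h3]; field_simp
  rw [h4, hG]
  field_simp
  ring

theorem descPochhammer_eval_natCast_of_lt {k n : ℕ} (h : k < n) :
    (descPochhammer ℂ n).eval (k : ℂ) = 0 := by
  have := descPochhammer_eval_eq_descFactorial ℂ k n
  rw [this, Nat.descFactorial_eq_zero_iff_lt.2 h, Nat.cast_zero]

/-- For a polynomial of degree `k ≤ m` the remainder disappears: the factor `u (u-1) ⋯ (u-m)`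
vanishes at `u = k`. -/
theorem riemannZeta_neg_natCast_eq {m k : ℕ} (hk : k < m) {X : ℝ} (hX : 0 < X) :
    riemannZeta (-k) = (∑ n ∈ Finset.Ioc 0 ⌊X⌋₊, (n : ℂ) ^ (k : ℂ)) -
      (X : ℂ) ^ ((k : ℂ) + 1) / (k + 1) - emBoundary (m + 1) (cpowDeriv k) X := by
  rw [riemannZeta_neg_eq m (u := k) (by simpa using hk)
    (fun h => by have := congrArg Complex.re h; simp at this; linarith [(k.cast_nonneg : (0:ℝ) ≤ k)])
    hX, descPochhammer_eval_natCast_of_lt (by lia)]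
  ring

/-- This is the `u`-derivative of `riemannZeta_neg_eq` at `u = k`. As the falling factorial vanishes
there, the product rule leaves only its derivative times the remainder integral; the derivative of
that integral drops out. -/
theorem neg_deriv_riemannZeta_neg_natCast_eq {m k : ℕ} (hk : k < m) {X : ℝ} (hX : 0 < X) :
    -deriv riemannZeta (-k) = (∑ n ∈ Finset.Ioc 0 ⌊X⌋₊, (n : ℂ) ^ (k : ℂ) * Complex.log n) -
      ((X : ℂ) ^ ((k : ℂ) + 1) * Complex.log X / (k + 1) - (X : ℂ) ^ ((k : ℂ) + 1) / (k + 1) ^ 2) -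
      emBoundary (m + 1) (cpowLogDeriv k) X +
      (-1) ^ m * ((descPochhammer ℂ (m + 1)).derivative.eval (k : ℂ) *
        cpowRemainder (m + 1) X k) := by
  have hk1 : (k : ℂ) + 1 ≠ 0 := by exact_mod_cast k.succ_ne_zero
  have hkn : (k : ℂ) ≠ -1 := fun h => hk1 (by rw [h]; ring)
  have hX0 : (X : ℂ) ≠ 0 := by exact_mod_cast hX.ne'
  have hζ : HasDerivAt (fun u : ℂ => riemannZeta (-u)) (-deriv riemannZeta (-k)) (k : ℂ) := by
    have h1 : DifferentiableAt ℂ riemannZeta (-(k : ℂ)) :=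
      differentiableAt_riemannZeta fun h => hkn (by rw [← h, neg_neg])
    refine (HasDerivAt.comp (h := fun u : ℂ => -u) (k : ℂ) h1.hasDerivAt
      (hasDerivAt_neg (k : ℂ))).congr_deriv (by ring)
  have hJ := (differentiableAt_cpowRemainder (m + 1) hX (u := k) (by simpa using hk)).hasDerivAt
  have hP := (descPochhammer ℂ (m + 1)).hasDerivAt (k : ℂ)
  have hXp : HasDerivAt (fun u : ℂ => (X : ℂ) ^ (u + 1))
      ((X : ℂ) ^ ((k : ℂ) + 1) * Complex.log X * 1) (k : ℂ) :=
    ((hasDerivAt_id (k : ℂ)).add_const (1 : ℂ)).const_cpow (Or.inl hX0)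
  have hR := (((hasDerivAt_sum_natCast_cpow ⌊X⌋₊ (k : ℂ)).sub
    (hXp.div ((hasDerivAt_id (k : ℂ)).add_const (1 : ℂ)) hk1)).sub
    (hasDerivAt_emBoundary_exponent (m + 1) (k : ℂ) hX)).add
    ((hP.mul hJ).const_mul ((-1 : ℂ) ^ m))
  have hev := hR.congr_of_eventuallyEq (f₁ := fun u : ℂ => riemannZeta (-u)) (by
    have h1 : {v : ℂ | v.re < m} ∈ nhds (k : ℂ) :=
      (isOpen_lt Complex.continuous_re continuous_const).mem_nhds (by simpa using hk)
    have h2 : {v : ℂ | v ≠ -1} ∈ nhds (k : ℂ) := isOpen_ne.mem_nhds hkn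
    filter_upwards [h1, h2] with v hv1 hv2
    exact riemannZeta_neg_eq m hv1 hv2 hX)
  rw [hζ.unique hev, descPochhammer_eval_natCast_of_lt (by lia : k < m + 1)]
  simp only [id]
  field_simp
  ring

theorem exists_norm_cpowRemainder_le {m k : ℕ} (hk : k < m) :
    ∃ C : ℝ, 0 ≤ C ∧ ∀ X : ℝ, 0 < X →
      ‖cpowRemainder (m + 1) X k‖ ≤ C * X ^ ((k : ℝ) - m) := by
  obtain ⟨C, hC0, hC⟩ := exists_abs_perBernoulli_le (m + 1)
  have hkm : (k : ℝ) < m := by exact_mod_cast hk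
  have hd : 0 < (m : ℝ) - k := by linarith
  refine ⟨C / (m - k), by positivity, fun X hX => ?_⟩
  have hexp : (k : ℝ) - (m + 1 : ℕ) < -1 := by push_cast; linarith
  have h : ‖cpowRemainder (m + 1) X k‖ ≤ ∫ x in Ioi X, C * x ^ ((k : ℝ) - (m + 1 : ℕ)) := by
    refine norm_integral_le_of_norm_le ((integrableOn_Ioi_rpow_of_lt hexp hX).const_mul C) ?_
    filter_upwards [ae_restrict_mem measurableSet_Ioi] with x hx
    have hx0 : 0 < x := hX.trans hx
    rw [norm_mul, Complex.norm_cpow_eq_rpow_re_of_pos hx0]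
    simp only [Complex.norm_real, Real.norm_eq_abs, Complex.sub_re, Complex.natCast_re]
    gcongr
    exact hC x
  refine h.trans (le_of_eq ?_)
  rw [integral_const_mul, integral_Ioi_rpow_of_lt hexp hX]
  have h1 : (k : ℝ) - (m + 1 : ℕ) + 1 = k - m := by push_cast; ring
  rw [h1]
  have : (k : ℝ) - m ≠ 0 := by linarith
  field_simp
  ring

/-! ### Real form: sums of powers and of powers times logarithm -/

/-- The successive derivatives of `x ↦ x ^ ν` on `(0, ∞)`. -/
noncomputable def rpowDeriv (ν : ℝ) (j : ℕ) (x : ℝ) : ℝ :=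
  (descPochhammer ℝ j).eval ν * x ^ (ν - j)

/-- The successive derivatives of `x ↦ x ^ ν * log x` on `(0, ∞)`. -/
noncomputable def rpowLogDeriv (ν : ℝ) (j : ℕ) (x : ℝ) : ℝ :=
  (descPochhammer ℝ j).derivative.eval ν * x ^ (ν - j) +
    (descPochhammer ℝ j).eval ν * (x ^ (ν - j) * Real.log x)

theorem hasDerivAt_rpowDeriv (ν : ℝ) (j : ℕ) {x : ℝ} (hx : 0 < x) :
    HasDerivAt (rpowDeriv ν j) (rpowDeriv ν (j + 1) x) x := by
  refine ((Real.hasDerivAt_rpow_const (p := ν - j) (Or.inl hx.ne')).const_mul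
    ((descPochhammer ℝ j).eval ν)).congr_deriv ?_
  rw [rpowDeriv, descPochhammer_succ_eval]
  push_cast
  rw [sub_sub]
  ring

theorem hasDerivAt_rpowLogDeriv (ν : ℝ) (j : ℕ) {x : ℝ} (hx : 0 < x) :
    HasDerivAt (rpowLogDeriv ν j) (rpowLogDeriv ν (j + 1) x) x := by
  have h1 := Real.hasDerivAt_rpow_const (p := ν - j) (Or.inl hx.ne' : x ≠ 0 ∨ 1 ≤ ν - j)
  refine ((h1.const_mul ((descPochhammer ℝ j).derivative.eval ν)).add
    ((h1.mul (Real.hasDerivAt_log hx.ne')).const_mul ((descPochhammer ℝ j).eval ν))).congr_deriv ?_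
  have h2 : x ^ (ν - j) * x⁻¹ = x ^ (ν - j - 1) := by
    rw [Real.rpow_sub_one hx.ne', div_eq_mul_inv]
  rw [rpowLogDeriv, descPochhammer_succ_eval, descPochhammer_succ_right, h2]
  push_cast
  rw [sub_sub]
  simp
  ring

theorem ofReal_descPochhammer_eval (ν : ℝ) (j : ℕ) :
    (((descPochhammer ℝ j).eval ν : ℝ) : ℂ) = (descPochhammer ℂ j).eval (ν : ℂ) := by
  rw [← descPochhammer_map Complex.ofRealHom, ← Complex.ofRealHom_eq_coe,
    ← Complex.ofRealHom_eq_coe, Polynomial.eval_map, Polynomial.eval₂_at_apply]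

theorem ofReal_derivative_descPochhammer_eval (ν : ℝ) (j : ℕ) :
    (((descPochhammer ℝ j).derivative.eval ν : ℝ) : ℂ) =
      (descPochhammer ℂ j).derivative.eval (ν : ℂ) := by
  rw [← descPochhammer_map Complex.ofRealHom, ← Complex.ofRealHom_eq_coe,
    ← Complex.ofRealHom_eq_coe, Polynomial.derivative_map, Polynomial.eval_map,
    Polynomial.eval₂_at_apply]

theorem ofReal_rpowDeriv (ν : ℝ) (j : ℕ) {x : ℝ} (hx : 0 < x) :
    (rpowDeriv ν j x : ℂ) = cpowDeriv ν j x := by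
  rw [rpowDeriv, cpowDeriv, Complex.ofReal_mul, ofReal_descPochhammer_eval,
    Complex.ofReal_cpow hx.le]
  push_cast
  rfl

theorem ofReal_rpowLogDeriv (ν : ℝ) (j : ℕ) {x : ℝ} (hx : 0 < x) :
    (rpowLogDeriv ν j x : ℂ) = cpowLogDeriv ν j x := by
  rw [rpowLogDeriv, cpowLogDeriv, Complex.ofReal_add, Complex.ofReal_mul, Complex.ofReal_mul,
    Complex.ofReal_mul, ofReal_descPochhammer_eval, ofReal_derivative_descPochhammer_eval,
    Complex.ofReal_cpow hx.le, Complex.ofReal_log hx.le]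
  push_cast
  rfl

theorem ofReal_emBoundary_eq (n : ℕ) {g : ℕ → ℝ → ℝ} {g' : ℕ → ℝ → ℂ} {X : ℝ}
    (h : ∀ j, (g j X : ℂ) = g' j X) : ((emBoundary n g X : ℝ) : ℂ) = emBoundary n g' X := by
  simp [emBoundary, h]

theorem integral_pow_mul_log (k : ℕ) {X : ℝ} (hX : 0 < X) :
    ∫ x in (0 : ℝ)..X, x ^ k * Real.log x =
      X ^ (k + 1) * Real.log X / (k + 1) - X ^ (k + 1) / (k + 1) ^ 2 := by
  have hk : (k : ℝ) + 1 ≠ 0 := by positivity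
  have h := intervalIntegral.integral_eq_sub_of_hasDerivAt_of_le hX.le
    -- Grouping `x * log x` makes the antiderivative visibly continuous at `0`.
    (f := fun x : ℝ => x ^ k * (x * Real.log x) / (k + 1) - x ^ (k + 1) / (k + 1) ^ 2)
    (f' := fun x => x ^ k * Real.log x)
    (by have := Real.continuous_mul_log; fun_prop)
    (fun x hx => by
      have h1 := (((hasDerivAt_pow (k + 1) x).mul (Real.hasDerivAt_log hx.1.ne')).div_const
        ((k : ℝ) + 1)).sub ((hasDerivAt_pow (k + 1) x).div_const (((k : ℝ) + 1) ^ 2))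
      refine (h1.congr_of_eventuallyEq (Eventually.of_forall fun y => ?_)).congr_deriv ?_
      · simp [pow_succ, mul_assoc]
      · have : x ≠ 0 := hx.1.ne'
        push_cast
        field_simp
        ring)
    (intervalIntegral.intervalIntegrable_log'.continuousOn_mul (by fun_prop))
  rw [h]
  simp [pow_succ]
  ring

/-- The Euler-Maclaurin formula for `x ↦ x ^ k`. -/
theorem sum_Ioc_pow_eq {m k : ℕ} (hk : k < m) {z : ℝ} (hz : (z : ℂ) = riemannZeta (-k))
    {X : ℝ} (hX : 0 < X) :
    ∑ n ∈ Finset.Ioc 0 ⌊X⌋₊, (n : ℝ) ^ k =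
      (∫ x in (0 : ℝ)..X, x ^ k) + emBoundary (m + 1) (rpowDeriv k) X + z := by
  have h := riemannZeta_neg_natCast_eq hk hX
  rw [← hz, ← ofReal_emBoundary_eq (m + 1) (g' := cpowDeriv k)
    (fun j => by simpa using ofReal_rpowDeriv k j hX)] at h
  have h1 : (k : ℂ) + 1 = ((k + 1 : ℕ) : ℂ) := by push_cast; rfl
  rw [h1] at h
  simp only [Complex.cpow_natCast] at h
  rw [integral_pow]
  have h2 : z = (∑ n ∈ Finset.Ioc 0 ⌊X⌋₊, (n : ℝ) ^ k) - X ^ (k + 1) / (k + 1) -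
      emBoundary (m + 1) (rpowDeriv k) X := by
    exact_mod_cast h
  rw [h2]
  simp

/-- The Euler-Maclaurin formula for `x ↦ x ^ k * log x`. -/
theorem exists_abs_sum_Ioc_pow_mul_log_sub_le {m k : ℕ} (hk : k < m) {y : ℝ}
    (hy : (y : ℂ) = -deriv riemannZeta (-k)) :
    ∃ C : ℝ, 0 ≤ C ∧ ∀ X : ℝ, 0 < X →
      |∑ n ∈ Finset.Ioc 0 ⌊X⌋₊, (n : ℝ) ^ k * Real.log n -
        ((∫ x in (0 : ℝ)..X, x ^ k * Real.log x) + emBoundary (m + 1) (rpowLogDeriv k) X + y)| ≤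
      C * X ^ ((k : ℝ) - m) := by
  obtain ⟨C, hC0, hC⟩ := exists_norm_cpowRemainder_le hk
  refine ⟨‖(descPochhammer ℂ (m + 1)).derivative.eval (k : ℂ)‖ * C, by positivity, fun X hX => ?_⟩
  have h := neg_deriv_riemannZeta_neg_natCast_eq hk hX
  rw [← hy, ← ofReal_emBoundary_eq (m + 1) (g' := cpowLogDeriv k)
    (fun j => by simpa using ofReal_rpowLogDeriv k j hX)] at h
  have h1 : (k : ℂ) + 1 = ((k + 1 : ℕ) : ℂ) := by push_cast; rfl
  rw [h1] at h
  simp only [Complex.cpow_natCast] at h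
  have hl : ∀ n : ℕ, Complex.log n = (Real.log n : ℂ) := fun n => (Complex.natCast_log).symm
  simp only [hl, ← Complex.ofReal_log hX.le] at h
  rw [← Real.norm_eq_abs, ← Complex.norm_real, integral_pow_mul_log k hX]
  have h2 : ((∑ n ∈ Finset.Ioc 0 ⌊X⌋₊, (n : ℝ) ^ k * Real.log n -
      ((X ^ (k + 1) * Real.log X / (k + 1) - X ^ (k + 1) / (k + 1) ^ 2) +
        emBoundary (m + 1) (rpowLogDeriv k) X + y) : ℝ) : ℂ) =
      -((-1) ^ m * ((descPochhammer ℂ (m + 1)).derivative.eval (k : ℂ) *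
        cpowRemainder (m + 1) X k)) := by
    push_cast
    rw [h]
    push_cast
    ring
  rw [h2, norm_neg, norm_mul, norm_mul, mul_assoc]
  simp only [norm_pow, norm_neg, norm_one, one_pow, one_mul]
  gcongr
  exact hC X hX

/-- Conjugation symmetry of `ζ` passes to its derivative, which is therefore real on the real axis.
-/
theorem exists_ofReal_eq_neg_deriv_riemannZeta (x : ℝ) :
    ∃ y : ℝ, (y : ℂ) = -deriv riemannZeta x := by
  have h : (starRingEnd ℂ ∘ riemannZeta ∘ starRingEnd ℂ) = riemannZeta := by
    ext s
    simp
  have h2 : deriv riemannZeta x = starRingEnd ℂ (deriv riemannZeta x) := by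
    conv_lhs => rw [← h, deriv_conj_conj]
    simp
  refine ⟨-(deriv riemannZeta x).re, ?_⟩
  rw [Complex.ofReal_neg, Complex.conj_eq_iff_re.1 h2.symm]

theorem riemannZeta_neg_two_mul_nat (k : ℕ) :
    ((if k = 0 then -1 / 2 else 0 : ℝ) : ℂ) = riemannZeta (-(2 * k : ℕ)) := by
  rcases k with _ | k
  · simp [riemannZeta_zero]
  · have := riemannZeta_neg_two_mul_nat_add_one k
    rw [if_neg k.succ_ne_zero, Complex.ofReal_zero]
    push_cast at this ⊢
    rw [← this]
    congr 1
    ring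

theorem sum_range_two_mul_eq_of_odd {E : Type*} [AddCommMonoid E] (K : ℕ) {F : ℕ → E} (hF : ∀ i, Odd i → F i = 0) :
    ∑ i ∈ Finset.range (2 * K), F i = ∑ k ∈ Finset.range K, F (2 * k) := by
  induction K with
  | zero => simp
  | succ K ih =>
    rw [show 2 * (K + 1) = 2 * K + 1 + 1 by ring, Finset.sum_range_succ, Finset.sum_range_succ, ih,
      hF (2 * K + 1) (odd_two_mul_add_one K), add_zero, Finset.sum_range_succ]

/-! ### Taylor remainders at the origin -/

section Taylor

variable {E : Type*} [NormedAddCommGroup E] [NormedSpace ℝ E]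

/-- A `C^n` function which vanishes to order `n` at `0` is `O(|x| ^ n)` on bounded intervals. -/
theorem exists_norm_le_of_iteratedDeriv_eq_zero {n : ℕ} {u : ℝ → E} (hu : ContDiff ℝ n u)
    (h0 : ∀ i < n, iteratedDeriv i u 0 = 0) (b : ℝ) :
    ∃ C : ℝ, 0 ≤ C ∧ ∀ x, |x| ≤ b → ‖u x‖ ≤ C * |x| ^ n := by
  induction n generalizing u with
  | zero =>
    obtain ⟨C, hC⟩ := (isCompact_Icc (a := -b) (b := b)).exists_bound_of_continuousOn
      hu.continuous.continuousOn
    refine ⟨max C 0, le_max_right _ _, fun x hx => ?_⟩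
    simpa using Or.inl (hC x (abs_le.1 hx))
  | succ n ih =>
    have hu' : ContDiff ℝ n (deriv u) := by
      have := (contDiff_succ_iff_deriv (n := n)).1 (by exact_mod_cast hu)
      exact this.2.2
    obtain ⟨C, hC0, hC⟩ := ih hu' (fun i hi => by
      rw [← iteratedDeriv_succ']; exact h0 (i + 1) (by lia))
    refine ⟨C, hC0, fun x hx => ?_⟩
    have hd : Differentiable ℝ u := hu.differentiable (by simp)
    -- Mean value inequality on `[-|x|, |x|]`, where the induction hypothesis bounds the derivative
    -- by `C |x|^n`.
    have := Convex.norm_image_sub_le_of_norm_deriv_le (f := u) (C := C * |x| ^ n)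
      (s := Icc (-|x|) |x|) (x := 0) (y := x) (fun y _ => hd y)
      (fun y hy => by
        have hy' : |y| ≤ |x| := abs_le.2 hy
        refine (hC y (hy'.trans hx)).trans ?_
        gcongr)
      (convex_Icc _ _) (by simp) (abs_le.1 le_rfl)
    have hu0 : u 0 = 0 := by simpa using h0 0 (by lia)
    rw [hu0] at this
    simpa [pow_succ, mul_assoc] using this

theorem exists_norm_iteratedDeriv_le_of_iteratedDeriv_eq_zero {n : ℕ} {u : ℝ → E}
    (hu : ContDiff ℝ n u) (h0 : ∀ i < n, iteratedDeriv i u 0 = 0) (b : ℝ) {i : ℕ} (hi : i ≤ n) :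
    ∃ C : ℝ, 0 ≤ C ∧ ∀ x, |x| ≤ b → ‖iteratedDeriv i u x‖ ≤ C * |x| ^ (n - i) := by
  refine exists_norm_le_of_iteratedDeriv_eq_zero ?_ (fun j hj => ?_) b
  · rw [iteratedDeriv_eq_iterate]
    exact ContDiff.iterate_deriv' (n - i) i (by rwa [Nat.sub_add_cancel hi])
  · rw [iteratedDeriv_eq_iterate, iteratedDeriv_eq_iterate, ← Function.iterate_add_apply,
      ← iteratedDeriv_eq_iterate]
    exact h0 _ (by lia)

/-- Subtracting the Taylor polynomial at `0`. -/
theorem iteratedDeriv_sub_taylor_eq_zero {n : ℕ} {f : ℝ → E} (hf : ContDiff ℝ n f) {j : ℕ}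
    (hj : j < n) :
    iteratedDeriv j (fun x => f x - ∑ i ∈ Finset.range n,
      x ^ i • ((i.factorial : ℝ)⁻¹ • iteratedDeriv i f 0)) 0 = 0 := by
  have hP : ∀ i, ContDiff ℝ j
      (fun x : ℝ => x ^ i • ((i.factorial : ℝ)⁻¹ • iteratedDeriv i f 0)) := fun i => by fun_prop
  have hf' : ContDiff ℝ j f := hf.of_le (by exact_mod_cast hj.le)
  have h := iteratedDeriv_sub (n := j) (x := (0 : ℝ)) hf'.contDiffAt
    (ContDiff.sum (fun i (_ : i ∈ Finset.range n) => hP i)).contDiffAt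
  refine h.trans ?_
  rw [iteratedDeriv_fun_sum fun i _ => (hP i).contDiffAt]
  have h2 : ∀ i, iteratedDeriv j
      (fun x : ℝ => x ^ i • ((i.factorial : ℝ)⁻¹ • iteratedDeriv i f 0)) 0 =
      if j = i then iteratedDeriv i f 0 else 0 := by
    intro i
    rw [iteratedDeriv_smul_const (by fun_prop), iteratedDeriv_fun_pow_zero]
    split_ifs with hij
    · rw [smul_smul, mul_inv_cancel₀ (by positivity), one_smul]
    · simp
  simp [h2, hj]

theorem iteratedDeriv_eq_zero_of_even {f : ℝ → E} (hf : ∀ x, f (-x) = f x) {i : ℕ} (hi : Odd i) :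
    iteratedDeriv i f 0 = 0 := by
  have h := iteratedDeriv_comp_neg i f 0
  simp only [hf, hi.neg_one_pow, neg_zero, neg_smul, one_smul] at h
  have h2 : (2 : ℝ) • iteratedDeriv i f 0 = 0 := by
    rw [two_smul]
    exact eq_neg_iff_add_eq_zero.1 h
  exact (smul_eq_zero.1 h2).resolve_left two_ne_zero

end Taylor

/-! ### Logarithm times a function flat at the origin -/

section LogSMul

variable {E : Type*} [NormedAddCommGroup E] [NormedSpace ℝ E]

/-- The successive derivatives of `x ↦ log x • r x` on `(0, ∞)`, extended by zero. -/
noncomputable def logSMulDeriv (r : ℝ → E) (j : ℕ) : ℝ → E :=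
  (Ioi 0).indicator (iteratedDerivWithin j (fun y => Real.log y • r y) (Ioi 0))

theorem contDiffOn_log_smul {n : ℕ} {r : ℝ → E} (hr : ContDiff ℝ n r) :
    ContDiffOn ℝ n (fun y => Real.log y • r y) (Ioi 0) :=
  (Real.contDiffOn_log.mono fun _ hx => ne_of_gt hx).smul hr.contDiffOn

theorem hasDerivAt_logSMulDeriv {n : ℕ} {r : ℝ → E} (hr : ContDiff ℝ n r) {j : ℕ} (hj : j < n)
    {x : ℝ} (hx : 0 < x) :
    HasDerivAt (logSMulDeriv r j) (logSMulDeriv r (j + 1) x) x := by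
  have hd := (contDiffOn_log_smul hr).differentiableOn_iteratedDerivWithin (m := j)
    (by exact_mod_cast hj) isOpen_Ioi.uniqueDiffOn
  have h1 := (hd.differentiableAt (isOpen_Ioi.mem_nhds hx)).hasDerivAt
  rw [← derivWithin_of_isOpen isOpen_Ioi hx, ← iteratedDerivWithin_succ] at h1
  rw [logSMulDeriv, logSMulDeriv, indicator_of_mem (show x ∈ Ioi (0 : ℝ) from hx)]
  refine h1.congr_of_eventuallyEq ?_
  filter_upwards [isOpen_Ioi.mem_nhds hx] with y hy
  exact indicator_of_mem hy _

theorem continuousOn_logSMulDeriv {n : ℕ} {r : ℝ → E} (hr : ContDiff ℝ n r) {j : ℕ} (hj : j ≤ n) :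
    ContinuousOn (logSMulDeriv r j) (Ioi 0) :=
  ((contDiffOn_log_smul hr).continuousOn_iteratedDerivWithin (by exact_mod_cast hj)
    isOpen_Ioi.uniqueDiffOn).congr fun _ hx => indicator_of_mem hx _

theorem abs_iteratedDeriv_log_le (l : ℕ) : ∃ C : ℝ, 0 ≤ C ∧ ∀ x : ℝ, 0 < x →
    |iteratedDeriv l Real.log x| * x ^ l ≤ C * (1 + |Real.log x|) := by
  rcases l with _ | l
  · exact ⟨1, zero_le_one, fun x _ => by simp⟩
  · refine ⟨l.factorial, by positivity, fun x hx => ?_⟩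
    rw [iteratedDeriv_succ', Real.deriv_log', iteratedDeriv_eq_iterate, iter_deriv_inv, abs_mul,
      abs_mul, abs_pow, abs_neg, abs_one, one_pow, one_mul, Nat.abs_cast, abs_of_pos (by positivity),
      mul_assoc, ← zpow_natCast, ← zpow_add₀ hx.ne']
    have : (-1 - (l : ℤ) + ((l + 1 : ℕ) : ℤ)) = 0 := by push_cast; ring
    rw [this, zpow_zero]
    gcongr
    linarith [abs_nonneg (Real.log x)]

/-- In Leibniz' formula the singularity `x^(-i)` of the `i`-th derivative of `log` is absorbed by
the derivative of order `j - i` of `r`, which is `O(x^(n-j+i))`. At `j = n` only an integrable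
logarithm remains. -/
theorem exists_norm_logSMulDeriv_le {n : ℕ} {r : ℝ → E} (hr : ContDiff ℝ n r)
    (h0 : ∀ i < n, iteratedDeriv i r 0 = 0) (b : ℝ) {j : ℕ} (hj : j ≤ n) :
    ∃ C : ℝ, 0 ≤ C ∧ ∀ x, 0 < x → x ≤ b →
      ‖logSMulDeriv r j x‖ ≤ C * (x ^ (n - j) * (1 + |Real.log x|)) := by
  choose A hA0 hA using abs_iteratedDeriv_log_le
  have hex : ∀ i, ∃ C : ℝ, 0 ≤ C ∧ (i ≤ n → ∀ x, |x| ≤ b →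
      ‖iteratedDeriv i r x‖ ≤ C * |x| ^ (n - i)) := by
    intro i
    by_cases hi : i ≤ n
    · obtain ⟨C, hC, h⟩ := exists_norm_iteratedDeriv_le_of_iteratedDeriv_eq_zero hr h0 b hi
      exact ⟨C, hC, fun _ => h⟩
    · exact ⟨0, le_rfl, fun h => absurd h hi⟩
  choose B hB0 hB using hex
  refine ⟨∑ i ∈ Finset.range (j + 1), (j.choose i : ℝ) * (A i * B (j - i)),
    Finset.sum_nonneg fun i _ => mul_nonneg (by positivity) (mul_nonneg (hA0 _) (hB0 _)),
    fun x hx hxb => ?_⟩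
  have hx' : x ∈ Ioi (0 : ℝ) := hx
  have hlog : ContDiffWithinAt ℝ j Real.log (Ioi 0) x :=
    (Real.contDiffAt_log.2 hx.ne').contDiffWithinAt
  have hrj : ContDiffWithinAt ℝ j r (Ioi 0) x :=
    (hr.of_le (by exact_mod_cast hj)).contDiffWithinAt
  rw [logSMulDeriv, indicator_of_mem hx']
  have hL := iteratedDerivWithin_smul hx' isOpen_Ioi.uniqueDiffOn hlog hrj
  change ‖iteratedDerivWithin j (Real.log • r) (Ioi 0) x‖ ≤ _
  rw [hL, Finset.sum_mul]
  refine norm_sum_le_of_le _ fun i hi => ?_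
  have hij : i ≤ j := by simpa [Nat.lt_succ_iff] using hi
  rw [iteratedDerivWithin_of_isOpen isOpen_Ioi hx', iteratedDerivWithin_of_isOpen isOpen_Ioi hx',
    ← Nat.cast_smul_eq_nsmul ℝ, norm_smul, norm_smul, Real.norm_natCast, mul_assoc]
  refine mul_le_mul_of_nonneg_left ?_ (Nat.cast_nonneg _)
  have h1 := hB (j - i) (by lia) x (by rwa [abs_of_pos hx])
  rw [abs_of_pos hx] at h1
  calc ‖iteratedDeriv i Real.log x‖ * ‖iteratedDeriv (j - i) r x‖
      ≤ |iteratedDeriv i Real.log x| * (B (j - i) * x ^ (n - (j - i))) := by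
        rw [Real.norm_eq_abs]; gcongr
    _ = (|iteratedDeriv i Real.log x| * x ^ i) * (B (j - i) * x ^ (n - j)) := by
        rw [show n - (j - i) = i + (n - j) by lia, pow_add]; ring
    _ ≤ (A i * (1 + |Real.log x|)) * (B (j - i) * x ^ (n - j)) := by
        have := hB0 (j - i)
        exact mul_le_mul_of_nonneg_right (hA i x hx) (by positivity)
    _ = _ := by ring

theorem tendsto_logSMulDeriv {n : ℕ} {r : ℝ → E} (hr : ContDiff ℝ n r)
    (h0 : ∀ i < n, iteratedDeriv i r 0 = 0) {j : ℕ} (hj : j < n) :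
    Tendsto (logSMulDeriv r j) (nhdsWithin 0 (Ioi 0)) (nhds 0) := by
  obtain ⟨C, hC0, hC⟩ := exists_norm_logSMulDeriv_le hr h0 1 hj.le
  have hlog : Tendsto (fun x : ℝ => |Real.log x * x|) (nhdsWithin 0 (Ioi 0)) (nhds 0) := by
    have := (tendsto_log_mul_rpow_nhdsGT_zero zero_lt_one).abs
    simpa using this
  have hid : Tendsto (fun x : ℝ => x) (nhdsWithin 0 (Ioi 0)) (nhds 0) :=
    tendsto_id.mono_left nhdsWithin_le_nhds
  have hlim : Tendsto (fun x : ℝ => C * (x + |Real.log x * x|)) (nhdsWithin 0 (Ioi 0)) (nhds 0) := by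
    simpa using (hid.add hlog).const_mul C
  refine squeeze_zero_norm' ?_ hlim
  filter_upwards [Ioo_mem_nhdsGT one_pos] with x hx
  refine (hC x hx.1 hx.2.le).trans ?_
  have hxp : x ^ (n - j) ≤ x := by
    calc x ^ (n - j) ≤ x ^ 1 := pow_le_pow_of_le_one hx.1.le hx.2.le (by lia)
      _ = x := pow_one x
  calc C * (x ^ (n - j) * (1 + |Real.log x|)) ≤ C * (x * (1 + |Real.log x|)) := by gcongr
    _ = C * (x + |Real.log x * x|) := by rw [abs_mul, abs_of_pos hx.1]; ring

theorem continuousOn_Icc_logSMulDeriv {n : ℕ} {r : ℝ → E} (hr : ContDiff ℝ n r)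
    (h0 : ∀ i < n, iteratedDeriv i r 0 = 0) {j : ℕ} (hj : j < n) (b : ℝ) :
    ContinuousOn (logSMulDeriv r j) (Icc 0 b) := by
  intro x hx
  rcases hx.1.eq_or_lt with rfl | hx0
  · have h1 : ContinuousWithinAt (logSMulDeriv r j) (Ioi 0) 0 := by
      rw [ContinuousWithinAt]
      simpa [logSMulDeriv] using tendsto_logSMulDeriv hr h0 hj
    rw [← continuousWithinAt_insert_self] at h1
    refine h1.mono fun y hy => ?_
    rcases hy.1.eq_or_lt with rfl | h
    · exact mem_insert _ _
    · exact mem_insert_of_mem _ h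
  · exact (hasDerivAt_logSMulDeriv hr hj hx0).continuousAt.continuousWithinAt

theorem intervalIntegrable_logSMulDeriv {n : ℕ} {r : ℝ → E} (hr : ContDiff ℝ n r)
    (h0 : ∀ i < n, iteratedDeriv i r 0 = 0) {b : ℝ} (hb : 0 ≤ b) :
    IntervalIntegrable (logSMulDeriv r n) volume 0 b := by
  obtain ⟨C, hC0, hC⟩ := exists_norm_logSMulDeriv_le hr h0 b le_rfl
  have hg : IntervalIntegrable (fun x => C * (1 + |Real.log x|)) volume 0 b :=
    ((by simp : IntervalIntegrable (fun _ => (1 : ℝ)) volume 0 b).add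
      intervalIntegral.intervalIntegrable_log'.abs).const_mul C
  rw [intervalIntegrable_iff_integrableOn_Ioc_of_le hb] at hg ⊢
  refine Integrable.mono' hg ?_ ?_
  · exact ((continuousOn_logSMulDeriv hr le_rfl).mono fun x hx => hx.1).aestronglyMeasurable
      measurableSet_Ioc
  · filter_upwards [ae_restrict_mem measurableSet_Ioc] with x hx
    simpa using hC x hx.1 hx.2

variable [CompleteSpace E]

/-- The Euler-Maclaurin formula for the dilates of `x ↦ log x • r x`, where `r` vanishes to
high order at `0`. -/
theorem exists_norm_sum_logSMulDeriv_sub_le {m : ℕ} {r : ℝ → E} (hr : ContDiff ℝ (m + 1 : ℕ) r)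
    (h0 : ∀ i < m + 1, iteratedDeriv i r 0 = 0) {a : ℝ} (ha : 0 < a) :
    ∃ C : ℝ, 0 ≤ C ∧ ∀ h X : ℝ, 0 < h → 0 < X → h * X = a →
      ‖∑ n ∈ Finset.Ioc 0 ⌊X⌋₊, logSMulDeriv r 0 (h * n) -
        ((∫ x in (0 : ℝ)..X, logSMulDeriv r 0 (h * x)) +
          emBoundary (m + 1) (fun j x => h ^ j • logSMulDeriv r j (h * x)) X)‖ ≤ C * h ^ m := by
  obtain ⟨B, hB0, hB⟩ := exists_abs_perBernoulli_le (m + 1)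
  refine ⟨B * ∫ x in (0 : ℝ)..a, ‖logSMulDeriv r (m + 1) x‖,
    mul_nonneg hB0.le (intervalIntegral.integral_nonneg ha.le fun _ _ => norm_nonneg _),
    fun h X hh hX hhX => ?_⟩
  set g : ℕ → ℝ → E := fun j x => h ^ j • logSMulDeriv r j (h * x) with hg
  have hint := intervalIntegrable_logSMulDeriv hr h0 ha.le
  have hint' : IntervalIntegrable (fun x => logSMulDeriv r (m + 1) (h * x)) volume 0 X := by
    have := hint.comp_mul_left (c := h)
    rwa [zero_div, ← hhX, mul_div_cancel_left₀ _ hh.ne'] at this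
  have hEM := sum_Ioc_eq_integral_add_emBoundary m (g := g) le_rfl hX.le
    (fun j hj => by
      refine ContinuousOn.const_smul ?_ _
      refine (continuousOn_Icc_logSMulDeriv hr h0 (by lia : j < m + 1) a).comp (by fun_prop) ?_
      intro x hx
      exact ⟨mul_nonneg hh.le hx.1, hhX ▸ mul_le_mul_of_nonneg_left hx.2 hh.le⟩)
    (fun j hj x hx => by
      have h1 := hasDerivAt_logSMulDeriv hr (by lia : j < m + 1) (mul_pos hh hx.1)
      have h2 := (h1.scomp x ((hasDerivAt_id x).const_mul h)).const_smul (h ^ j)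
      refine h2.congr_deriv ?_
      simp only [hg, mul_one, smul_smul, pow_succ])
    (hint'.smul _)
  -- The derivatives are extended by zero at the origin, which agrees with their limits for orders
  -- at most `m`; hence no boundary term arises there.
  have hz : emBoundary (m + 1) g 0 = 0 := by
    simp [emBoundary, hg, logSMulDeriv]
  rw [hz, sub_zero, Nat.floor_zero] at hEM
  simp only [hg, pow_zero, one_smul] at hEM
  rw [hEM, add_sub_cancel_left, norm_smul, norm_pow, norm_neg, norm_one, one_pow, one_mul]
  have hbd : ‖∫ x in (0 : ℝ)..X,
      perBernoulli (m + 1) x • h ^ (m + 1) • logSMulDeriv r (m + 1) (h * x)‖ ≤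
      ∫ x in (0 : ℝ)..X, B * (h ^ (m + 1) * ‖logSMulDeriv r (m + 1) (h * x)‖) := by
    refine intervalIntegral.norm_integral_le_of_norm_le hX.le (ae_of_all _ fun x _ => ?_)
      ((hint'.norm.const_mul _).const_mul _)
    rw [norm_smul, norm_smul, Real.norm_of_nonneg (by positivity : 0 ≤ h ^ (m + 1))]
    gcongr
    exact hB x
  -- The chain rule gives `h^(m+1)`; the substitution `x ↦ hx` in the integral costs one power.
  refine hbd.trans (le_of_eq ?_)
  rw [intervalIntegral.integral_const_mul, intervalIntegral.integral_const_mul,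
    intervalIntegral.integral_comp_mul_left (fun x => ‖logSMulDeriv r (m + 1) x‖) hh.ne', mul_zero,
    hhX, smul_eq_mul, pow_succ]
  field_simp

end LogSMul

/-! ### Vanishing and linearity of boundary terms -/

section Boundary

variable {E : Type*} [NormedAddCommGroup E] [NormedSpace ℝ E]

/-- Derivatives vanish on the open half-line, and continuity at `X` carries this to the endpoint. -/
theorem eq_zero_of_hasDerivAt_of_eq_zero_right {g : ℕ → ℝ → E} {X : ℝ} {n : ℕ}
    (hder : ∀ j < n, ∀ x, X ≤ x → HasDerivAt (g j) (g (j + 1) x) x) (h0 : ∀ x, X < x → g 0 x = 0)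
    {j : ℕ} (hj : j < n) : g j X = 0 := by
  have hright : ∀ i, i < n → ∀ x, X < x → g i x = 0 := by
    intro i
    induction i with
    | zero => exact fun _ => h0
    | succ i ih =>
      intro hi x hx
      have hev : g i =ᶠ[nhds x] fun _ => 0 := by
        filter_upwards [isOpen_Ioi.mem_nhds hx] with y hy
        exact ih (by lia) y hy
      exact ((hder i (by lia) x hx.le).congr_of_eventuallyEq hev.symm).unique (hasDerivAt_const x 0)
  have hc : Tendsto (g j) (nhdsWithin X (Ioi X)) (nhds (g j X)) :=
    (hder j hj X le_rfl).continuousAt.continuousWithinAt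
  refine tendsto_nhds_unique hc (tendsto_const_nhds.congr' ?_)
  filter_upwards [self_mem_nhdsWithin] with x hx
  exact (hright j hj x hx).symm

theorem emBoundary_add (n : ℕ) (g₁ g₂ : ℕ → ℝ → E) (X : ℝ) :
    emBoundary n (fun j x => g₁ j x + g₂ j x) X = emBoundary n g₁ X + emBoundary n g₂ X := by
  simp [emBoundary, Finset.sum_add_distrib]

theorem emBoundary_sum {ι : Type*} (s : Finset ι) (n : ℕ) (g : ι → ℕ → ℝ → E) (X : ℝ) :
    emBoundary n (fun j x => ∑ i ∈ s, g i j x) X = ∑ i ∈ s, emBoundary n (g i) X := by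
  simp only [emBoundary, Finset.smul_sum]
  exact Finset.sum_comm

theorem emBoundary_const_smul (n : ℕ) (c : ℝ) (g : ℕ → ℝ → E) (X : ℝ) :
    emBoundary n (fun j x => c • g j x) X = c • emBoundary n g X := by
  simp only [emBoundary, Finset.smul_sum]
  exact Finset.sum_congr rfl fun j _ => by module

theorem emBoundary_smul_const (n : ℕ) (g : ℕ → ℝ → ℝ) (c : E) (X : ℝ) :
    emBoundary n (fun j x => g j x • c) X = emBoundary n g X • c := by
  simp [emBoundary, Finset.sum_smul, smul_smul]

/-- The difference between the sum over the integers in `(0, X]` and the integral over `[0, X]`. -/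
noncomputable def sumSubIntegral (X : ℝ) (g : ℝ → E) : E :=
  ∑ n ∈ Finset.Ioc 0 ⌊X⌋₊, g n - ∫ x in (0 : ℝ)..X, g x

theorem sumSubIntegral_congr {X : ℝ} (hX : 0 ≤ X) {g₁ g₂ : ℝ → E} (h : ∀ x, 0 < x → g₁ x = g₂ x) :
    sumSubIntegral X g₁ = sumSubIntegral X g₂ := by
  rw [sumSubIntegral, sumSubIntegral, intervalIntegral.integral_congr_ae (ae_of_all _ fun x hx =>
    h x (by rw [uIoc_of_le hX] at hx; exact hx.1))]
  congr 1
  exact Finset.sum_congr rfl fun n hn => h n (by exact_mod_cast (Finset.mem_Ioc.1 hn).1)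

theorem sumSubIntegral_add {X : ℝ} {g₁ g₂ : ℝ → E} (h₁ : IntervalIntegrable g₁ volume 0 X)
    (h₂ : IntervalIntegrable g₂ volume 0 X) :
    sumSubIntegral X (fun x => g₁ x + g₂ x) = sumSubIntegral X g₁ + sumSubIntegral X g₂ := by
  rw [sumSubIntegral, intervalIntegral.integral_add h₁ h₂, Finset.sum_add_distrib, sumSubIntegral,
    sumSubIntegral]
  abel

theorem sumSubIntegral_sum {ι : Type*} (s : Finset ι) {X : ℝ} {g : ι → ℝ → E}
    (h : ∀ i ∈ s, IntervalIntegrable (g i) volume 0 X) :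
    sumSubIntegral X (fun x => ∑ i ∈ s, g i x) = ∑ i ∈ s, sumSubIntegral X (g i) := by
  rw [sumSubIntegral, intervalIntegral.integral_finsetSum h, Finset.sum_comm,
    ← Finset.sum_sub_distrib]
  rfl

theorem sumSubIntegral_const_smul (X c : ℝ) (g : ℝ → E) :
    sumSubIntegral X (fun x => c • g x) = c • sumSubIntegral X g := by
  rw [sumSubIntegral, intervalIntegral.integral_smul, ← Finset.smul_sum, ← smul_sub, sumSubIntegral]

theorem sumSubIntegral_smul_const [CompleteSpace E] (X : ℝ) (g : ℝ → ℝ) (c : E) :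
    sumSubIntegral X (fun x => g x • c) = sumSubIntegral X g • c := by
  rw [sumSubIntegral, intervalIntegral.integral_smul_const, ← Finset.sum_smul, ← sub_smul,
    sumSubIntegral]

end Boundary

/-! ### Singular Euler-Maclaurin expansion for even functions -/

section Even

variable {E : Type*} [NormedAddCommGroup E] [NormedSpace ℝ E]

/-- The Taylor coefficient of order `i` at `0`. -/
noncomputable def taylorCoeffZero (f : ℝ → E) (i : ℕ) : E :=
  (i.factorial : ℝ)⁻¹ • iteratedDeriv i f 0

/-- The Taylor remainder of an even function. -/
noncomputable def evenTaylorRemainder (K : ℕ) (f : ℝ → E) (x : ℝ) : E :=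
  f x - ∑ k ∈ Finset.range (K + 1), x ^ (2 * k) • taylorCoeffZero f (2 * k)

theorem evenTaylorRemainder_eq {f : ℝ → E} (hf : ∀ x, f (-x) = f x) (K : ℕ) :
    evenTaylorRemainder K f = fun x => f x - ∑ i ∈ Finset.range (2 * (K + 1)),
      x ^ i • ((i.factorial : ℝ)⁻¹ • iteratedDeriv i f 0) := by
  ext x
  rw [sum_range_two_mul_eq_of_odd (K + 1)
    (F := fun i => x ^ i • ((i.factorial : ℝ)⁻¹ • iteratedDeriv i f 0))
    (fun i hi => by simp [iteratedDeriv_eq_zero_of_even hf hi])]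
  rfl

theorem contDiff_evenTaylorRemainder {f : ℝ → E} {n : WithTop ℕ∞} (hf : ContDiff ℝ n f) (K : ℕ) :
    ContDiff ℝ n (evenTaylorRemainder K f) :=
  hf.sub (ContDiff.sum fun k _ => by fun_prop)

theorem iteratedDeriv_evenTaylorRemainder_eq_zero {K : ℕ} {f : ℝ → E}
    (hf : ContDiff ℝ (2 * K + 1 + 1 : ℕ) f) (heven : ∀ x, f (-x) = f x) {i : ℕ}
    (hi : i < 2 * K + 1 + 1) :
    iteratedDeriv i (evenTaylorRemainder K f) 0 = 0 := by
  rw [evenTaylorRemainder_eq heven]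
  exact iteratedDeriv_sub_taylor_eq_zero hf hi

theorem rpowLogDeriv_zero (k : ℕ) (x : ℝ) : rpowLogDeriv k 0 x = x ^ k * Real.log x := by
  simp [rpowLogDeriv]

theorem rpowDeriv_zero (k : ℕ) (x : ℝ) : rpowDeriv k 0 x = x ^ k := by
  simp [rpowDeriv]

/-- The successive derivatives of `x ↦ log (h x) • f (h x)` on `(0, ∞)`, split along the Taylor
expansion of `f` at `0`. -/
noncomputable def splitDeriv (K : ℕ) (f : ℝ → E) (h : ℝ) (j : ℕ) (x : ℝ) : E :=
  (∑ k ∈ Finset.range (K + 1), h ^ (2 * k) • (rpowLogDeriv (2 * k : ℕ) j x +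
    Real.log h • rpowDeriv (2 * k : ℕ) j x) • taylorCoeffZero f (2 * k)) +
  h ^ j • logSMulDeriv (evenTaylorRemainder K f) j (h * x)

theorem splitDeriv_zero (K : ℕ) (f : ℝ → E) {h x : ℝ} (hh : 0 < h) (hx : 0 < x) :
    splitDeriv K f h 0 x = Real.log (h * x) • f (h * x) := by
  have hhx : h * x ∈ Ioi (0 : ℝ) := mul_pos hh hx
  rw [splitDeriv, pow_zero, one_smul, logSMulDeriv, indicator_of_mem hhx, iteratedDerivWithin_zero,
    evenTaylorRemainder, smul_sub, Finset.smul_sum, add_comm, sub_add, sub_eq_self, sub_eq_zero]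
  refine Finset.sum_congr rfl fun k _ => ?_
  rw [rpowLogDeriv_zero, rpowDeriv_zero, smul_smul, smul_smul, Real.log_mul hh.ne' hx.ne', mul_pow,
    smul_eq_mul]
  congr 1
  ring

theorem hasDerivAt_splitDeriv {K : ℕ} {f : ℝ → E} (hf : ContDiff ℝ (2 * K + 1 + 1 : ℕ) f) {h : ℝ}
    (hh : 0 < h) {j : ℕ} (hj : j < 2 * K + 1 + 1) {x : ℝ} (hx : 0 < x) :
    HasDerivAt (splitDeriv K f h j) (splitDeriv K f h (j + 1) x) x := by
  have h1 := hasDerivAt_logSMulDeriv (contDiff_evenTaylorRemainder hf K) hj (mul_pos hh hx)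
  have h2 := (h1.scomp x ((hasDerivAt_id x).const_mul h)).const_smul (h ^ j)
  have h3 : HasDerivAt (fun x => h ^ j • logSMulDeriv (evenTaylorRemainder K f) j (h * x))
      (h ^ (j + 1) • logSMulDeriv (evenTaylorRemainder K f) (j + 1) (h * x)) x :=
    h2.congr_deriv (by simp only [mul_one, smul_smul, pow_succ])
  refine HasDerivAt.add (HasDerivAt.fun_sum fun k _ => ?_) h3
  exact (((hasDerivAt_rpowLogDeriv _ j hx).add
    ((hasDerivAt_rpowDeriv _ j hx).const_smul (Real.log h))).smul_const
    (taylorCoeffZero f (2 * k))).const_smul (h ^ (2 * k))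

/-- The pieces have nonzero boundary terms at `X`, but together they are derivatives of `log (hx) •
f (hx)`, which vanishes to the right of `X`. This cancellation eliminates every endpoint correction
at `a`. -/
theorem emBoundary_splitDeriv_eq_zero {K : ℕ} {f : ℝ → E} (hf : ContDiff ℝ (2 * K + 1 + 1 : ℕ) f)
    {a : ℝ} (hfa : ∀ x, a ≤ x → f x = 0) {h X : ℝ} (hh : 0 < h) (hX : 0 < X) (hhX : h * X = a) :
    emBoundary (2 * K + 1 + 1) (splitDeriv K f h) X = 0 := by
  refine Finset.sum_eq_zero fun j hj => ?_
  rw [eq_zero_of_hasDerivAt_of_eq_zero_right (X := X) (n := 2 * K + 1 + 1)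
    (fun j hj x hx => hasDerivAt_splitDeriv hf hh hj (hX.trans_le hx)) (fun x hx => ?_)
    (Finset.mem_range.1 hj), smul_zero, smul_zero]
  rw [splitDeriv_zero K f hh (hX.trans hx), hfa _ (hhX ▸ mul_le_mul_of_nonneg_left hx.le hh.le),
    smul_zero]

theorem emBoundary_splitDeriv (n K : ℕ) (f : ℝ → E) (h X : ℝ) :
    emBoundary n (splitDeriv K f h) X =
      (∑ k ∈ Finset.range (K + 1), h ^ (2 * k) • (emBoundary n (rpowLogDeriv (2 * k : ℕ)) X +
        Real.log h • emBoundary n (rpowDeriv (2 * k : ℕ)) X) • taylorCoeffZero f (2 * k)) +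
      emBoundary n (fun j x => h ^ j • logSMulDeriv (evenTaylorRemainder K f) j (h * x)) X := by
  unfold splitDeriv
  rw [emBoundary_add, emBoundary_sum]
  simp only [emBoundary_const_smul, emBoundary_smul_const, emBoundary_add]

theorem intervalIntegrable_pow_mul_log (k : ℕ) (X : ℝ) :
    IntervalIntegrable (fun x => x ^ k * Real.log x) volume 0 X :=
  intervalIntegral.intervalIntegrable_log'.continuousOn_mul (by fun_prop)

variable [CompleteSpace E]

theorem sumSubIntegral_splitDeriv {K : ℕ} {f : ℝ → E} (hf : ContDiff ℝ (2 * K + 1 + 1 : ℕ) f)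
    (heven : ∀ x, f (-x) = f x) {h X : ℝ} (hh : 0 < h) (hX : 0 < X) :
    sumSubIntegral X (splitDeriv K f h 0) =
      (∑ k ∈ Finset.range (K + 1), h ^ (2 * k) • (sumSubIntegral X (fun x => x ^ (2 * k) * Real.log x) +
        Real.log h • sumSubIntegral X (fun x => x ^ (2 * k))) • taylorCoeffZero f (2 * k)) +
      sumSubIntegral X (fun x => logSMulDeriv (evenTaylorRemainder K f) 0 (h * x)) := by
  unfold splitDeriv
  simp only [rpowLogDeriv_zero, rpowDeriv_zero, pow_zero, one_smul]
  have hp : ∀ k : ℕ, IntervalIntegrable (fun x : ℝ => Real.log h • x ^ (2 * k)) volume 0 X :=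
    fun k => (by fun_prop : Continuous fun x : ℝ => Real.log h • x ^ (2 * k)).intervalIntegrable _ _
  have hs : ∀ k ∈ Finset.range (K + 1), IntervalIntegrable (fun x : ℝ => h ^ (2 * k) •
      (x ^ (2 * k) * Real.log x + Real.log h • x ^ (2 * k)) • taylorCoeffZero f (2 * k))
      volume 0 X := fun k _ => by
    have h1 := (intervalIntegrable_pow_mul_log (2 * k) X).add (hp k)
    exact IntervalIntegrable.smul (f := fun x : ℝ => (x ^ (2 * k) * Real.log x +
      Real.log h • x ^ (2 * k)) • taylorCoeffZero f (2 * k))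
      ⟨h1.1.smul_const _, h1.2.smul_const _⟩ _
  rw [sumSubIntegral_add, sumSubIntegral_sum _ hs]
  · congr 1
    refine Finset.sum_congr rfl fun k _ => ?_
    rw [sumSubIntegral_const_smul, sumSubIntegral_smul_const,
      sumSubIntegral_add (intervalIntegrable_pow_mul_log (2 * k) X) (hp k),
      sumSubIntegral_const_smul]
  · have := IntervalIntegrable.sum (Finset.range (K + 1)) hs
    simpa [Finset.sum_fn] using this
  · refine ContinuousOn.intervalIntegrable_of_Icc hX.le ?_
    refine (continuousOn_Icc_logSMulDeriv (contDiff_evenTaylorRemainder hf K)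
      (fun i hi => iteratedDeriv_evenTaylorRemainder_eq_zero hf heven hi)
      (by lia : 0 < 2 * K + 1 + 1) (h * X)).comp (by fun_prop) ?_
    exact fun x hx => ⟨mul_nonneg hh.le hx.1, mul_le_mul_of_nonneg_left hx.2 hh.le⟩

/-- The singular Euler-Maclaurin expansion of the punctured trapezoidal sum of `log x • f x`. -/
theorem exists_norm_sum_log_smul_sub_le {K : ℕ} {f : ℝ → E}
    (hf : ContDiff ℝ (2 * K + 1 + 1 : ℕ) f) (heven : ∀ x, f (-x) = f x) {a : ℝ} (ha : 0 < a)
    (hfa : ∀ x, a ≤ x → f x = 0) {y : ℕ → ℝ}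
    (hy : ∀ k ≤ K, (y k : ℂ) = -deriv riemannZeta (-(2 * k : ℕ))) :
    ∃ C : ℝ, 0 ≤ C ∧ ∀ h X : ℝ, 0 < h → 0 < X → h * X = a →
      ‖h • ∑ n ∈ Finset.Ioc 0 ⌊X⌋₊, Real.log (h * n) • f (h * n) -
        ((∫ x in (0 : ℝ)..a, Real.log x • f x) +
          h • ((∑ k ∈ Finset.range (K + 1), (h ^ (2 * k) * y k) • taylorCoeffZero f (2 * k)) -
            (Real.log h / 2) • f 0))‖ ≤ C * h ^ (2 * K + 2) := by
  obtain ⟨C₀, hC₀, hR⟩ := exists_norm_sum_logSMulDeriv_sub_le (m := 2 * K + 1)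
    (contDiff_evenTaylorRemainder hf K)
    (fun i hi => iteratedDeriv_evenTaylorRemainder_eq_zero hf heven hi) ha
  have hL : ∀ k : ℕ, ∃ C : ℝ, 0 ≤ C ∧ (k ≤ K → ∀ X : ℝ, 0 < X →
      |sumSubIntegral X (fun x => x ^ (2 * k) * Real.log x) -
        (emBoundary (2 * K + 1 + 1) (rpowLogDeriv (2 * k : ℕ)) X + y k)| ≤
        C * X ^ (((2 * k : ℕ) : ℝ) - (2 * K + 1 : ℕ))) := by
    intro k
    by_cases hk : k ≤ K
    · obtain ⟨C, hC, h⟩ := exists_abs_sum_Ioc_pow_mul_log_sub_le (m := 2 * K + 1) (k := 2 * k)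
        (by lia) (hy k hk)
      refine ⟨C, hC, fun _ X hX => ?_⟩
      rw [sumSubIntegral, sub_sub, ← add_assoc]
      exact h X hX
    · exact ⟨0, le_rfl, fun h => absurd h hk⟩
  choose C₁ hC₁ hL using hL
  refine ⟨(∑ k ∈ Finset.range (K + 1), C₁ k * a ^ (((2 * k : ℕ) : ℝ) - (2 * K + 1 : ℕ)) *
    ‖taylorCoeffZero f (2 * k)‖) + C₀, add_nonneg (Finset.sum_nonneg fun k _ => by
      have := hC₁ k; positivity) hC₀, fun h X hh hX hhX => ?_⟩
  have hP : ∀ k ≤ K, sumSubIntegral X (fun x => x ^ (2 * k)) =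
      emBoundary (2 * K + 1 + 1) (rpowDeriv (2 * k : ℕ)) X + if k = 0 then -1 / 2 else 0 := by
    intro k hk
    rw [sumSubIntegral, sum_Ioc_pow_eq (m := 2 * K + 1) (k := 2 * k) (by lia)
      (riemannZeta_neg_two_mul_nat k) hX]
    ring
  have hG : sumSubIntegral X (fun x => Real.log (h * x) • f (h * x)) =
      sumSubIntegral X (splitDeriv K f h 0) :=
    sumSubIntegral_congr hX.le fun x hx => (splitDeriv_zero K f hh hx).symm
  have hB := emBoundary_splitDeriv_eq_zero hf hfa hh hX hhX
  rw [emBoundary_splitDeriv] at hB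
  have hR' := hR h X hh hX hhX
  rw [← sub_sub] at hR'
  change ‖sumSubIntegral X (fun x => logSMulDeriv (evenTaylorRemainder K f) 0 (h * x)) - _‖ ≤ _ at hR'
  rw [sumSubIntegral_splitDeriv hf heven hh hX] at hG
  have hscale : (∫ x in (0 : ℝ)..a, Real.log x • f x) =
      h • ∫ x in (0 : ℝ)..X, Real.log (h * x) • f (h * x) := by
    rw [intervalIntegral.smul_integral_comp_mul_left (fun x => Real.log x • f x), mul_zero, hhX]
  set ρ : ℕ → ℝ := fun k => sumSubIntegral X (fun x => x ^ (2 * k) * Real.log x) -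
    (emBoundary (2 * K + 1 + 1) (rpowLogDeriv (2 * k : ℕ)) X + y k) with hρ
  set R : E := sumSubIntegral X (fun x => logSMulDeriv (evenTaylorRemainder K f) 0 (h * x)) -
    emBoundary (2 * K + 1 + 1)
      (fun j x => h ^ j • logSMulDeriv (evenTaylorRemainder K f) j (h * x)) X with hRdef
  -- The trivial zeros kill all terms but `k = 0`, where `ζ(0) = -1/2` produces the `log h`
  -- correction.
  have hzero : (∑ k ∈ Finset.range (K + 1), (h ^ (2 * k) * (Real.log h * if k = 0 then -1 / 2 else 0)) •
      taylorCoeffZero f (2 * k)) = -((Real.log h / 2) • f 0) := by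
    rw [Finset.sum_eq_single 0 (fun k _ hk => by simp [hk]) (by simp)]
    simp [taylorCoeffZero, ← neg_smul]
    congr 1
    ring
  -- After the boundary terms cancel through `hB`, only the zeta constants and the remainders `ρ k`
  -- and `R` are left.
  have key : sumSubIntegral X (fun x => Real.log (h * x) • f (h * x)) -
      ((∑ k ∈ Finset.range (K + 1), (h ^ (2 * k) * y k) • taylorCoeffZero f (2 * k)) -
            (Real.log h / 2) • f 0) =
      (∑ k ∈ Finset.range (K + 1), (h ^ (2 * k) * ρ k) • taylorCoeffZero f (2 * k)) + R := by
    rw [hG, sub_eq_add_neg (∑ k ∈ Finset.range (K + 1), _) ((Real.log h / 2) • f 0), ← hzero,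
      hRdef]
    have hsum : (∑ k ∈ Finset.range (K + 1), h ^ (2 * k) •
          (sumSubIntegral X (fun x => x ^ (2 * k) * Real.log x) +
          Real.log h • sumSubIntegral X (fun x => x ^ (2 * k))) • taylorCoeffZero f (2 * k)) =
        (∑ k ∈ Finset.range (K + 1), (h ^ (2 * k) * y k) • taylorCoeffZero f (2 * k)) +
        (∑ k ∈ Finset.range (K + 1), (h ^ (2 * k) * (Real.log h * if k = 0 then -1 / 2 else 0)) •
          taylorCoeffZero f (2 * k)) +
        (∑ k ∈ Finset.range (K + 1), (h ^ (2 * k) * ρ k) • taylorCoeffZero f (2 * k)) +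
        (∑ k ∈ Finset.range (K + 1), h ^ (2 * k) •
          (emBoundary (2 * K + 1 + 1) (rpowLogDeriv (2 * k : ℕ)) X +
          Real.log h • emBoundary (2 * K + 1 + 1) (rpowDeriv (2 * k : ℕ)) X) •
          taylorCoeffZero f (2 * k)) := by
      rw [← Finset.sum_add_distrib, ← Finset.sum_add_distrib, ← Finset.sum_add_distrib]
      refine Finset.sum_congr rfl fun k hk => ?_
      rw [hP k (by simpa [Nat.lt_succ_iff] using hk), hρ]
      simp only [smul_eq_mul]
      module
    rw [hsum, eq_neg_of_add_eq_zero_left hB]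
    abel
  have hfac : h • ∑ n ∈ Finset.Ioc 0 ⌊X⌋₊, Real.log (h * n) • f (h * n) -
        ((∫ x in (0 : ℝ)..a, Real.log x • f x) +
          h • ((∑ k ∈ Finset.range (K + 1), (h ^ (2 * k) * y k) • taylorCoeffZero f (2 * k)) -
            (Real.log h / 2) • f 0)) =
      h • ((∑ k ∈ Finset.range (K + 1), (h ^ (2 * k) * ρ k) • taylorCoeffZero f (2 * k)) + R) := by
    rw [← key, hscale, sumSubIntegral]
    module
  rw [hfac, norm_smul, Real.norm_of_nonneg hh.le, show 2 * K + 2 = (2 * K + 1) + 1 by ring, pow_succ,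
    mul_comm h, ← mul_assoc]
  refine mul_le_mul_of_nonneg_right ?_ hh.le
  rw [add_mul]
  refine (norm_add_le _ _).trans (add_le_add ?_ hR')
  rw [Finset.sum_mul]
  refine norm_sum_le_of_le _ fun k hk => ?_
  have hk' : k ≤ K := by simpa [Nat.lt_succ_iff] using hk
  -- Since `X = a / h`, the decay `X^(2k-2K-1)` of the remainder turns `h^(2k)` into `h^(2K+1)` for
  -- every `k`.
  have hpow : h ^ (2 * k) * X ^ (((2 * k : ℕ) : ℝ) - (2 * K + 1 : ℕ)) =
      a ^ (((2 * k : ℕ) : ℝ) - (2 * K + 1 : ℕ)) * h ^ (2 * K + 1) := by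
    rw [← hhX, Real.mul_rpow hh.le hX.le, Real.rpow_sub hh, Real.rpow_natCast, Real.rpow_natCast]
    field_simp
  rw [norm_smul, norm_mul, Real.norm_of_nonneg (by positivity : 0 ≤ h ^ (2 * k))]
  calc h ^ (2 * k) * ‖ρ k‖ * ‖taylorCoeffZero f (2 * k)‖
      ≤ h ^ (2 * k) * (C₁ k * X ^ (((2 * k : ℕ) : ℝ) - (2 * K + 1 : ℕ))) *
          ‖taylorCoeffZero f (2 * k)‖ := by
        gcongr
        exact hL k hk' X hX
    _ = C₁ k * (h ^ (2 * k) * X ^ (((2 * k : ℕ) : ℝ) - (2 * K + 1 : ℕ))) *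
          ‖taylorCoeffZero f (2 * k)‖ := by ring
    _ = _ := by rw [hpow]; ring

end Even

/-! ### Existence and uniqueness of the weights -/

section Weights

/-- The matrix is Vandermonde in the distinct nodes `0, 1, 4, …, K^2`, and the right-hand sides are
real. -/
theorem existsUnique_isZetaPrimeWeights (K : ℕ) :
    ∃! w : Fin (K + 1) → ℝ, IsZetaPrimeWeights K w := by
  choose y hy using fun k : ℕ => exists_ofReal_eq_neg_deriv_riemannZeta (-(2 * k : ℕ))
  set V : Matrix (Fin (K + 1)) (Fin (K + 1)) ℝ :=
    Matrix.vandermonde fun j => ((j : ℕ) : ℝ) ^ 2 with hV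
  have hdet : IsUnit V.det := by
    refine isUnit_iff_ne_zero.2 (Matrix.det_vandermonde_ne_zero_iff.2 fun i j hij => ?_)
    have : ((i : ℕ) : ℝ) = (j : ℕ) :=
      (pow_left_inj₀ (Nat.cast_nonneg _) (Nat.cast_nonneg _) two_ne_zero).1 hij
    exact Fin.ext (by exact_mod_cast this)
  have hiff : ∀ w, IsZetaPrimeWeights K w ↔
      Matrix.vecMul w V = fun k : Fin (K + 1) => y k := by
    intro w
    have h1 : ∀ k : Fin (K + 1), Matrix.vecMul w V k =
        ∑ j : Fin (K + 1), w j * ((j : ℕ) : ℝ) ^ (2 * (k : ℕ)) := fun k => by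
      simp [hV, Matrix.vecMul, dotProduct, Matrix.vandermonde_apply, pow_mul]
    have h2 : ∀ k : ℕ, -deriv riemannZeta (-(2 * (k : ℂ))) = (y k : ℂ) := fun k => by
      rw [hy]; push_cast; rfl
    constructor
    · intro hw
      ext k
      have := hw k (by lia)
      rw [h2] at this
      rw [h1]
      exact_mod_cast this
    · intro hw k hk
      have := congrFun hw ⟨k, by lia⟩
      rw [h1] at this
      rw [h2, ← this]
  refine ⟨Matrix.vecMul (fun k : Fin (K + 1) => y k) V⁻¹, ?_, fun w hw => ?_⟩
  · refine (hiff _).2 ?_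
    rw [Matrix.vecMul_vecMul, Matrix.nonsing_inv_mul V hdet, Matrix.vecMul_one]
  · rw [← (hiff w).1 hw, Matrix.vecMul_vecMul, Matrix.mul_nonsing_inv V hdet, Matrix.vecMul_one]

end Weights

/-! ### Regularity and flatness of the cutoff -/

section Cutoff

variable {E : Type*} [NormedAddCommGroup E] [NormedSpace ℝ E]

/-- The support of a continuous function is open, so it lies in the interior of the interval; thus
`η` vanishes at `±a` as well. -/
theorem eq_zero_of_tsupport_subset_Icc {η : ℝ → ℝ} {a : ℝ} (hη : Continuous η)
    (hs : tsupport η ⊆ Icc (-a) a) {x : ℝ} (hx : x ∉ Ioo (-a) a) : η x = 0 := by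
  by_contra hne
  have hsub : Function.support η ⊆ Icc (-a) a := (subset_tsupport η).trans hs
  have hopen : IsOpen (Function.support η) := hη.isOpen_support
  have hint := hopen.subset_interior_iff.2 hsub
  rw [interior_Icc] at hint
  exact hx (hint hne)

/-- Where `g` need not be differentiable on both sides, `η` and `η'` vanish; then `η y = o(y - x)`,
and boundedness of `g` on the interval is enough. -/
theorem hasDerivAt_smul_of_tsupport_subset {η : ℝ → ℝ} {a : ℝ} (hη : ContDiff ℝ 1 η)
    (hs : tsupport η ⊆ Icc (-a) a) {g : ℝ → E} (hg : ContDiffOn ℝ ∞ g (Icc (-a) a)) (x : ℝ) :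
    HasDerivAt (fun x => η x • g x)
      (η x • derivWithin g (Icc (-a) a) x + deriv η x • g x) x := by
  have hdη : HasDerivAt η (deriv η x) x := (hη.differentiable (by simp) x).hasDerivAt
  by_cases hx : x ∈ Ioo (-a) a
  · have hmem : Icc (-a) a ∈ nhds x := Icc_mem_nhds hx.1 hx.2
    have hdg : DifferentiableWithinAt ℝ g (Icc (-a) a) x :=
      hg.differentiableOn (by simp) x (Ioo_subset_Icc_self hx)
    exact hdη.smul (hdg.hasDerivWithinAt.hasDerivAt hmem)
  · have h1 : η x = 0 := eq_zero_of_tsupport_subset_Icc hη.continuous hs hx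
    have h2 : deriv η x = 0 := eq_zero_of_tsupport_subset_Icc (hη.continuous_deriv le_rfl)
      ((tsupport_deriv_subset (f := η)).trans hs) hx
    obtain ⟨B, hB⟩ := isCompact_Icc.exists_bound_of_continuousOn hg.continuousOn
    rw [h2] at hdη
    rw [h1, h2, zero_smul, zero_smul, add_zero, hasDerivAt_iff_isLittleO]
    rw [hasDerivAt_iff_isLittleO] at hdη
    simp only [h1, smul_zero, sub_zero, zero_smul] at hdη ⊢
    refine IsBigO.trans_isLittleO (IsBigO.of_bound B (Eventually.of_forall fun y => ?_)) hdη
    rw [norm_smul, mul_comm]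
    by_cases hy : y ∈ Icc (-a) a
    · exact mul_le_mul_of_nonneg_right (hB y hy) (norm_nonneg _)
    · rw [eq_zero_of_tsupport_subset_Icc hη.continuous hs fun h => hy (Ioo_subset_Icc_self h)]
      simp

/-- The derivative `η g' + η' g` is a sum of two products of the same kind with one order less on
the cutoff, so induction applies. Values of `g` outside the interval never matter. -/
theorem contDiff_smul_of_tsupport_subset {n : ℕ} {η : ℝ → ℝ} {a : ℝ} (ha : 0 < a)
    (hη : ContDiff ℝ n η) (hs : tsupport η ⊆ Icc (-a) a) {g : ℝ → E}
    (hg : ContDiffOn ℝ ∞ g (Icc (-a) a)) : ContDiff ℝ n (fun x => η x • g x) := by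
  have haa : -a ≤ a := by linarith
  induction n generalizing η g with
  | zero =>
    simp only [Nat.cast_zero, contDiff_zero] at hη ⊢
    have h1 : (fun x => η x • g x) = fun x => η x • IccExtend haa ((Icc (-a) a).domRestrict g) x := by
      ext x
      by_cases hx : x ∈ Icc (-a) a
      · rw [IccExtend_of_mem haa _ hx, domRestrict_apply]
      · rw [eq_zero_of_tsupport_subset_Icc hη hs fun h => hx (Ioo_subset_Icc_self h), zero_smul,
          zero_smul]
    rw [h1]
    exact hη.smul (continuousOn_iff_continuous_domRestrict.1 hg.continuousOn).Icc_extend'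
  | succ n ih =>
    have hη1 : ContDiff ℝ 1 η := hη.of_le (by push_cast; exact le_add_self)
    have hη' : ContDiff ℝ n (deriv η) :=
      ((contDiff_succ_iff_deriv (n := n)).1 (by exact_mod_cast hη)).2.2
    have hd := hasDerivAt_smul_of_tsupport_subset hη1 hs hg
    have hder : deriv (fun x => η x • g x) =
        fun x => η x • derivWithin g (Icc (-a) a) x + deriv η x • g x := funext fun x => (hd x).deriv
    push_cast
    refine contDiff_succ_iff_deriv.2 ⟨fun x => (hd x).differentiableAt, by simp, ?_⟩
    rw [hder]
    refine ContDiff.add (ih (hη.of_le (by exact_mod_cast n.le_succ)) hs ?_)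
      (ih hη' ((tsupport_deriv_subset (f := η)).trans hs) hg)
    exact hg.derivWithin (uniqueDiffOn_Icc (by linarith)) (by simp)

theorem IsCutoff.exists_abs_sub_one_le {a : ℝ} {p m : ℕ} {η : ℝ → ℝ} (hη : IsCutoff a p m η)
    (hmp : m < p) (b : ℝ) :
    ∃ C : ℝ, 0 ≤ C ∧ ∀ x, |x| ≤ b → |η x - 1| ≤ C * |x| ^ (m + 1) := by
  have hc : ContDiff ℝ (m + 1 : ℕ) fun x => η x - 1 :=
    (hη.contDiff.of_le (by exact_mod_cast hmp)).sub contDiff_const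
  refine exists_norm_le_of_iteratedDeriv_eq_zero hc (fun i hi => ?_) b
  rcases i with _ | i
  · simp [hη.map_zero]
  · have : deriv (fun x => η x - 1) = deriv η := by
      ext x
      rw [deriv_sub_const]
    rw [iteratedDeriv_succ', this, ← iteratedDeriv_succ']
    exact hη.iteratedDeriv_zero (i + 1) (by lia) (by lia)

end Cutoff

/-! ### Folding onto the positive half-line -/

section Symmetrization

theorem integral_symm_eq {E : Type*} [NormedAddCommGroup E] [NormedSpace ℝ E] {g : ℝ → E} {a : ℝ}
    (ha : 0 ≤ a) (hg : IntervalIntegrable g volume (-a) a) :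
    ∫ x in (-a)..a, g x = ∫ x in (0 : ℝ)..a, (g x + g (-x)) := by
  have h0 : (0 : ℝ) ∈ uIcc (-a) a := by rw [uIcc_of_le (by linarith)]; constructor <;> linarith
  have h1 : IntervalIntegrable g volume (-a) 0 :=
    hg.mono_set (uIcc_subset_uIcc left_mem_uIcc h0)
  have h2 : IntervalIntegrable g volume 0 a :=
    hg.mono_set (uIcc_subset_uIcc h0 right_mem_uIcc)
  have h3 : IntervalIntegrable (fun x => g (-x)) volume 0 a := by
    simpa using ((IntervalIntegrable.iff_comp_neg).1 h1).symm
  rw [intervalIntegral.integral_add h2 h3, intervalIntegral.integral_comp_neg, neg_zero, add_comm,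
    intervalIntegral.integral_add_adjacent_intervals h1 h2]

theorem sum_Icc_erase_zero_eq {E : Type*} [AddCommMonoid E] (M : ℕ) (g : ℤ → E) :
    ∑ n ∈ (Finset.Icc (-(M : ℤ)) (M : ℤ)).erase 0, g n =
      ∑ n ∈ Finset.Ioc 0 M, (g n + g (-n)) := by
  induction M with
  | zero => simp
  | succ M ih =>
    have h : (Finset.Icc (-((M + 1 : ℕ) : ℤ)) ((M + 1 : ℕ) : ℤ)).erase 0 =
        insert ((M + 1 : ℕ) : ℤ) (insert (-((M + 1 : ℕ) : ℤ))
          ((Finset.Icc (-(M : ℤ)) (M : ℤ)).erase 0)) := by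
      ext n
      simp only [Finset.mem_erase, Finset.mem_Icc, Finset.mem_insert]
      lia
    rw [h, Finset.sum_insert (by simp; lia), Finset.sum_insert (by simp), ih,
      Finset.sum_Ioc_succ_top (Nat.zero_le M), ← add_assoc, add_comm]

end Symmetrization

/-- The moment equations say exactly that `∑ w_j P(jh)` reproduces the zeta constants on even
polynomials `P` of degree at most `2K`; here `P` is the Taylor polynomial, written as `f` minus its
remainder. -/
theorem sum_taylorCoeffZero_eq_sum_weights {E : Type*} [NormedAddCommGroup E] [NormedSpace ℝ E]
    {K : ℕ} {w : Fin (K + 1) → ℝ} {y : ℕ → ℝ}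
    (hw : ∀ k ≤ K, ∑ j : Fin (K + 1), w j * ((j : ℕ) : ℝ) ^ (2 * k) = y k) (f : ℝ → E) (h : ℝ) :
    ∑ k ∈ Finset.range (K + 1), (h ^ (2 * k) * y k) • taylorCoeffZero f (2 * k) =
      ∑ j : Fin (K + 1), w j • (f ((j : ℕ) * h) - evenTaylorRemainder K f ((j : ℕ) * h)) := by
  simp only [evenTaylorRemainder, sub_sub_cancel, Finset.smul_sum]
  rw [Finset.sum_comm]
  refine Finset.sum_congr rfl fun k hk => ?_
  rw [← hw k (by simpa [Nat.lt_succ_iff] using hk), Finset.mul_sum, Finset.sum_smul]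
  refine Finset.sum_congr rfl fun j _ => ?_
  rw [smul_smul, mul_pow]
  congr 1
  ring

/-! ### Assembly of the quadrature formula -/

section Assembly

variable {𝕜 : Type*} [RCLike 𝕜]

theorem spacing_pos {a : ℝ} (ha : 0 < a) (M : ℕ) : 0 < spacing a M := by
  rw [spacing]; positivity

theorem spacing_mul {a : ℝ} (M : ℕ) : spacing a M * ((M : ℝ) + 1 / 2) = a := by
  rw [spacing]
  have : (M : ℝ) + 1 / 2 ≠ 0 := by positivity
  field_simp

theorem natCast_mul_spacing_le {a : ℝ} (ha : 0 < a) {j M : ℕ} (hj : j ≤ M) :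
    (j : ℝ) * spacing a M ≤ a := by
  have h := spacing_pos ha M
  have hj' : (j : ℝ) ≤ M := by exact_mod_cast hj
  calc (j : ℝ) * spacing a M ≤ ((M : ℝ) + 1 / 2) * spacing a M := by gcongr; linarith
    _ = a := by rw [mul_comm, spacing_mul]

theorem floor_add_half (M : ℕ) : ⌊(M : ℝ) + 1 / 2⌋₊ = M := by
  rw [Nat.floor_eq_iff (by positivity)]
  constructor <;> linarith

theorem intervalIntegrable_negLogAbs_mul {F : ℝ → 𝕜} (hF : Continuous F) (a b : ℝ) :
    IntervalIntegrable (fun x => ((negLogAbs x : ℝ) : 𝕜) * F x) volume a b := by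
  have h1 : IntervalIntegrable (fun x => negLogAbs x • F x) volume a b := by
    have h2 : IntervalIntegrable negLogAbs volume a b := by
      unfold negLogAbs
      simp only [Real.log_abs]
      exact intervalIntegral.intervalIntegrable_log'.neg
    exact h2.smul_continuousOn hF.continuousOn
  simpa only [RCLike.real_smul_eq_coe_mul] using h1

theorem integral_negLogAbs_mul {F : ℝ → 𝕜} (hF : Continuous F) {a : ℝ} (ha : 0 < a) :
    I a (fun x => ((negLogAbs x : ℝ) : 𝕜) * F x) =
      -∫ x in (0 : ℝ)..a, Real.log x • (F x + F (-x)) := by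
  rw [I, integral_symm_eq ha.le (intervalIntegrable_negLogAbs_mul hF _ _),
    ← intervalIntegral.integral_neg]
  congr 1
  ext x
  simp only [negLogAbs, abs_neg, Real.log_abs, RCLike.real_smul_eq_coe_mul]
  push_cast
  ring

theorem puncturedTrapezoidal_negLogAbs_mul (F : ℝ → 𝕜) (a : ℝ) (M : ℕ) :
    puncturedTrapezoidal a M (fun x => ((negLogAbs x : ℝ) : 𝕜) * F x) =
      -(spacing a M • ∑ n ∈ Finset.Ioc 0 M, Real.log (spacing a M * n) •
        (F (spacing a M * n) + F (-(spacing a M * n)))) := by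
  rw [puncturedTrapezoidal, sum_Icc_erase_zero_eq, Finset.smul_sum, ← Finset.sum_neg_distrib]
  refine Finset.sum_congr rfl fun n _ => ?_
  simp only [negLogAbs, Int.cast_neg, Int.cast_natCast, neg_mul, abs_neg, Real.log_abs,
    RCLike.real_smul_eq_coe_mul, mul_comm (n : ℝ)]
  push_cast
  ring

/-- The symmetrization `F x + F (-x)` of `F = η • τ`. -/
noncomputable def symmCutoff (η : ℝ → ℝ) (τ : ℝ → 𝕜) (x : ℝ) : 𝕜 :=
  η x • τ x + η (-x) • τ (-x)

/-- Replacing `τ` by `η • τ` in the correction terms costs only `O(h ^ (2 K + 2))`. -/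
theorem isBigO_weights_cutoff {K : ℕ} {a : ℝ} {p : ℕ} {η : ℝ → ℝ} {τ : ℝ → 𝕜} (ha : 0 < a)
    (hp : 2 * K + 1 < p) (hη : IsCutoff a p (2 * K + 1) η) (hτ : ContinuousOn τ (Icc (-a) a))
    (w : Fin (K + 1) → ℝ) :
    (fun M : ℕ => ∑ j : Fin (K + 1), w j •
      (symmCutoff η τ ((j : ℕ) * spacing a M) -
        (τ ((j : ℕ) * spacing a M) + τ (-((j : ℕ) * spacing a M)))))
      =O[atTop] (fun M : ℕ => spacing a M ^ (2 * K + 2)) := by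
  obtain ⟨C, hC0, hC⟩ := hη.exists_abs_sub_one_le hp a
  obtain ⟨B, hB⟩ := isCompact_Icc.exists_bound_of_continuousOn hτ
  refine IsBigO.fun_sum fun j _ => ?_
  refine IsBigO.of_bound (|w j| * (C * ((j : ℕ) : ℝ) ^ (2 * K + 2) * B +
    C * ((j : ℕ) : ℝ) ^ (2 * K + 2) * B)) ?_
  -- For `M ≥ K` every node `±jh` with `j ≤ K` lies in `[-a, a]`, where the bounds on `τ` and `η -
  -- 1` hold.
  filter_upwards [eventually_ge_atTop K] with M hM
  have hh := spacing_pos ha M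
  set x : ℝ := (j : ℕ) * spacing a M with hx
  have hx0 : 0 ≤ x := by positivity
  have hxa : x ≤ a := natCast_mul_spacing_le ha (by lia)
  have hmem : x ∈ Icc (-a) a := ⟨by linarith, hxa⟩
  have hmem' : -x ∈ Icc (-a) a := ⟨by linarith, by linarith⟩
  have h1 := hC x (by rwa [abs_of_nonneg hx0])
  have h2 := hC (-x) (by rwa [abs_neg, abs_of_nonneg hx0])
  rw [abs_neg] at h2
  rw [abs_of_nonneg hx0] at h1 h2
  have hB0 : 0 ≤ B := (norm_nonneg _).trans (hB x hmem)
  have hpow : x ^ (2 * K + 1 + 1) = ((j : ℕ) : ℝ) ^ (2 * K + 2) * spacing a M ^ (2 * K + 2) := by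
    rw [hx, mul_pow]
  have heq : symmCutoff η τ x - (τ x + τ (-x)) = (η x - 1) • τ x + (η (-x) - 1) • τ (-x) := by
    rw [symmCutoff]; module
  rw [norm_smul, Real.norm_eq_abs, heq, Real.norm_of_nonneg (by positivity), mul_assoc]
  refine mul_le_mul_of_nonneg_left ?_ (abs_nonneg _)
  rw [add_mul]
  refine (norm_add_le _ _).trans (add_le_add ?_ ?_)
  · rw [norm_smul, Real.norm_eq_abs]
    calc |η x - 1| * ‖τ x‖ ≤ (C * x ^ (2 * K + 1 + 1)) * B := by gcongr; exact hB x hmem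
      _ = _ := by rw [hpow]; ring
  · rw [norm_smul, Real.norm_eq_abs]
    calc |η (-x) - 1| * ‖τ (-x)‖ ≤ (C * x ^ (2 * K + 1 + 1)) * B := by gcongr; exact hB _ hmem'
      _ = _ := by rw [hpow]; ring

theorem isBigO_weights_evenTaylorRemainder {E : Type*} [NormedAddCommGroup E] [NormedSpace ℝ E]
    {K : ℕ} {f : ℝ → E} (hf : ContDiff ℝ (2 * K + 1 + 1 : ℕ) f) (heven : ∀ x, f (-x) = f x)
    {a : ℝ} (ha : 0 < a) (w : Fin (K + 1) → ℝ) :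
    (fun M : ℕ => ∑ j : Fin (K + 1), w j • evenTaylorRemainder K f ((j : ℕ) * spacing a M))
      =O[atTop] (fun M : ℕ => spacing a M ^ (2 * K + 2)) := by
  obtain ⟨C, hC0, hC⟩ := exists_norm_le_of_iteratedDeriv_eq_zero
    (contDiff_evenTaylorRemainder hf K)
    (fun i hi => iteratedDeriv_evenTaylorRemainder_eq_zero hf heven hi) a
  refine IsBigO.fun_sum fun j _ => ?_
  refine IsBigO.of_bound (|w j| * (C * ((j : ℕ) : ℝ) ^ (2 * K + 2))) ?_
  filter_upwards [eventually_ge_atTop K] with M hM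
  have hh := spacing_pos ha M
  have hx0 : 0 ≤ ((j : ℕ) : ℝ) * spacing a M := by positivity
  have h1 := hC (((j : ℕ) : ℝ) * spacing a M)
    (by rw [abs_of_nonneg hx0]; exact natCast_mul_spacing_le ha (by lia))
  rw [abs_of_nonneg hx0, mul_pow] at h1
  rw [norm_smul, Real.norm_eq_abs, Real.norm_of_nonneg (by positivity), mul_assoc, mul_assoc]
  exact mul_le_mul_of_nonneg_left h1 (abs_nonneg _)

theorem isBigO_spacing_smul {E : Type*} [NormedAddCommGroup E] [NormedSpace ℝ E] {a : ℝ}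
    (ha : 0 < a) {u : ℕ → E} {v : ℕ → ℝ} (hu : u =O[atTop] v) :
    (fun M => spacing a M • u M) =O[atTop] v := by
  have h1 : (fun M : ℕ => spacing a M) =O[atTop] fun _ => (1 : ℝ) := by
    refine IsBigO.of_bound (2 * a) (Eventually.of_forall fun M => ?_)
    rw [Real.norm_of_nonneg (spacing_pos ha M).le, norm_one, mul_one, spacing,
      div_le_iff₀ (by positivity)]
    have : (0 : ℝ) ≤ M := M.cast_nonneg
    nlinarith
  simpa using h1.smul hu

/-- The corrected trapezoidal rule for `-log |x|`. -/
theorem correctedTrapezoidal_isBigO {K : ℕ} {w : Fin (K + 1) → ℝ}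
    (hw : IsZetaPrimeWeights K w) {a : ℝ} {p : ℕ} {η : ℝ → ℝ} {τ : ℝ → 𝕜} (ha : 0 < a)
    (hp : 2 * K + 1 < p) (hη : IsCutoff a p (2 * K + 1) η)
    (hτ : ContDiffOn ℝ ∞ τ (Icc (-a) a)) :
    (fun M : ℕ => I a (fun x => ((negLogAbs x : ℝ) : 𝕜) * (η x • τ x)) -
      (puncturedTrapezoidal a M (fun x => ((negLogAbs x : ℝ) : 𝕜) * (η x • τ x)) -
        (spacing a M * Real.log (spacing a M)) • τ 0 +
        spacing a M • ∑ j : Fin (K + 1), w j •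
          (τ ((j : ℕ) * spacing a M) + τ (-((j : ℕ) * spacing a M)))))
      =O[atTop] (fun M : ℕ => spacing a M ^ (2 * K + 2)) := by
  have hF : ContDiff ℝ (2 * K + 1 + 1 : ℕ) fun x => η x • τ x :=
    contDiff_smul_of_tsupport_subset ha (hη.contDiff.of_le (by exact_mod_cast hp))
      hη.tsupport_subset hτ
  have hf : ContDiff ℝ (2 * K + 1 + 1 : ℕ) (symmCutoff η τ) := hF.add (hF.comp contDiff_neg)
  have heven : ∀ x, symmCutoff η τ (-x) = symmCutoff η τ x := fun x => by
    rw [symmCutoff, symmCutoff, neg_neg, add_comm]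
  have hfa : ∀ x, a ≤ x → symmCutoff η τ x = 0 := fun x hx => by
    have hη0 : ∀ x, x ∉ Ioo (-a) a → η x = 0 := fun x hx =>
      eq_zero_of_tsupport_subset_Icc hη.contDiff.continuous hη.tsupport_subset hx
    rw [symmCutoff, hη0 x (fun h => absurd h.2 (not_lt.2 hx)),
      hη0 (-x) (fun h => by linarith [h.1]), zero_smul, zero_smul, add_zero]
  have hf0 : symmCutoff η τ 0 = (2 : ℝ) • τ 0 := by
    rw [symmCutoff, neg_zero, hη.map_zero, one_smul, two_smul]
  choose y hy using fun k : ℕ => exists_ofReal_eq_neg_deriv_riemannZeta (-(2 * k : ℕ))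
  have hwy : ∀ k ≤ K, ∑ j : Fin (K + 1), w j * ((j : ℕ) : ℝ) ^ (2 * k) = y k := by
    intro k hk
    have h1 := hw k hk
    have h2 : -deriv riemannZeta (-(2 * (k : ℂ))) = (y k : ℂ) := by
      rw [hy]; push_cast; rfl
    rw [h2] at h1
    exact_mod_cast h1
  obtain ⟨C, -, hC⟩ := exists_norm_sum_log_smul_sub_le hf heven ha hfa (y := y)
    (fun k _ => by rw [hy]; push_cast; rfl)
  have hcore : (fun M : ℕ => spacing a M • ∑ n ∈ Finset.Ioc 0 M,
      Real.log (spacing a M * n) • symmCutoff η τ (spacing a M * n) -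
        ((∫ x in (0 : ℝ)..a, Real.log x • symmCutoff η τ x) +
          spacing a M • ((∑ k ∈ Finset.range (K + 1), (spacing a M ^ (2 * k) * y k) •
            taylorCoeffZero (symmCutoff η τ) (2 * k)) -
            (Real.log (spacing a M) / 2) • symmCutoff η τ 0)))
      =O[atTop] (fun M : ℕ => spacing a M ^ (2 * K + 2)) := by
    refine IsBigO.of_bound C (Eventually.of_forall fun M => ?_)
    have hh := spacing_pos ha M
    have := hC (spacing a M) ((M : ℝ) + 1 / 2) hh (by positivity) (spacing_mul M)
    rw [floor_add_half] at this
    rwa [Real.norm_of_nonneg (by positivity)]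
  -- Three errors combine: the singular expansion, the replacement of `η τ` by `τ` at the nodes, and
  -- that of the Taylor polynomial by `f`. The rest is linear algebra, with `f 0 = 2 τ 0` absorbing
  -- the half.
  refine ((hcore.add (isBigO_spacing_smul ha (isBigO_weights_cutoff ha hp hη hτ.continuousOn w))).sub
    (isBigO_spacing_smul ha (isBigO_weights_evenTaylorRemainder hf heven ha w))).congr_left
    fun M => ?_
  rw [sum_taylorCoeffZero_eq_sum_weights hwy, integral_negLogAbs_mul hF.continuous ha,
    puncturedTrapezoidal_negLogAbs_mul (fun x => η x • τ x), hf0]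
  simp only [smul_sub, Finset.sum_sub_distrib, smul_smul]
  simp only [symmCutoff]
  module

end Assembly

end CorrectedTrapezoidal

theorem mainTheorem2 (K : ℕ) :
    (∃! w : Fin (K + 1) → ℝ, CorrectedTrapezoidal.IsZetaPrimeWeights K w) ∧
    ∀ w : Fin (K + 1) → ℝ, CorrectedTrapezoidal.IsZetaPrimeWeights K w →
      ∀ {𝕜 : Type*} [RCLike 𝕜] (a : ℝ) (p : ℕ) (η : ℝ → ℝ) (τ : ℝ → 𝕜),
        0 < a → 2 * K + 1 < p →
        CorrectedTrapezoidal.IsCutoff a p (2 * K + 1) η →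
        ContDiffOn ℝ ∞ τ (Icc (-a) a) →
        IntervalIntegrable
          (fun x : ℝ => (CorrectedTrapezoidal.negLogAbs x : 𝕜) * τ x * (η x : 𝕜))
          volume (-a) a ∧
        (fun M : ℕ =>
          CorrectedTrapezoidal.I a
              (fun x : ℝ => (CorrectedTrapezoidal.negLogAbs x : 𝕜) * τ x * (η x : 𝕜)) -
            (CorrectedTrapezoidal.puncturedTrapezoidal a M
                (fun x : ℝ => (CorrectedTrapezoidal.negLogAbs x : 𝕜) * τ x * (η x : 𝕜)) -
              τ 0 * ((CorrectedTrapezoidal.spacing a M *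
                Real.log (CorrectedTrapezoidal.spacing a M) : ℝ) : 𝕜) +
              (CorrectedTrapezoidal.spacing a M : 𝕜) *
                ∑ j : Fin (K + 1), (w j : 𝕜) *
                  (τ (((j : ℕ) : ℝ) * CorrectedTrapezoidal.spacing a M) +
                    τ (-(((j : ℕ) : ℝ) * CorrectedTrapezoidal.spacing a M)))))
          =O[atTop] (fun M : ℕ => CorrectedTrapezoidal.spacing a M ^ (2 * K + 2)) := by
  refine ⟨CorrectedTrapezoidal.existsUnique_isZetaPrimeWeights K,
    fun w hw 𝕜 _ a p η τ ha hp hη hτ => ?_⟩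
  have hfun : (fun x : ℝ => (CorrectedTrapezoidal.negLogAbs x : 𝕜) * τ x * (η x : 𝕜)) =
      fun x => ((CorrectedTrapezoidal.negLogAbs x : ℝ) : 𝕜) * (η x • τ x) := by
    ext x
    rw [RCLike.real_smul_eq_coe_mul]
    ring
  rw [hfun]
  constructor
  · refine CorrectedTrapezoidal.intervalIntegrable_negLogAbs_mul ?_ _ _
    exact (CorrectedTrapezoidal.contDiff_smul_of_tsupport_subset ha
      (hη.contDiff.of_le (by exact_mod_cast hp.le)) hη.tsupport_subset hτ
      (n := 2 * K + 1)).continuous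
  · refine (CorrectedTrapezoidal.correctedTrapezoidal_isBigO hw ha hp hη hτ).congr_left fun M => ?_
    simp only [RCLike.real_smul_eq_coe_mul, mul_comm (τ 0)]
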